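/- Let $|\cdot|$ be the Euclidean norm, let $A$ be a compact metric space, and let $f:\mathbb R^2\times A\to\mathbb R^2$ be continuous with $|f(x,a)|\le M$ and $|f(x,a)-f(y,a)|\le M|x-y|$ for some $M>0$ and all $x,y\in\mathbb R^2$, $a\in A$. Put $|f|_\infty=\sup_{x,a}|f(x,a)|$, $d(x)=x_1^2x_2^2$, and let $\Gamma=\{O\}\cup\bigcup_{i}(0,\infty)e_i$, where $O=(0,0)$ and $e_i$ runs over $(\pm1,0),(0,\pm1)$. Let $x\in\mathbb R^2$ and let $\alpha:(0,\infty)\to A$ be measurable. Then the following hold. (1) For every $\varepsilon>0$ there is a unique $X^\varepsilon\in W^{1,\infty}_{\rm loc}[0,\infty)$ with $\dot X^\varepsilon=f(X^\varepsilon,\alpha)-\frac1\varepsilon\nabla d(X^\varepsilon)$ a.e. on $(0,\infty)$ and $X^\varepsilon(0)=x$. Put $k^\varepsilon(t)=\frac1\varepsilon\int_0^t\nabla d(X^\varepsilon(s))\,ds$. (2) The gradient descent $\dot Z=-\nabla d(Z)$, $Z(0)=x$, has a unique solution on $[0,\infty)$, and $\overline x:=\lim_{t\to\infty}Z(t)$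 exists and lies in $\Gamma$. Every sequence $\varepsilon_n\to0^+$ has a subsequence along which $(X^{\varepsilon},k^{\varepsilon})$ converges to some pair $(X,k)$ locally uniformly on $(0,\infty)$ and pointwise at $t=0$. Every pair $(X,k)$ that is a limit in this sense along some sequence $\varepsilon_n\to 0^+$ belongs to $H^1_{\rm loc}(0,\infty)\times H^1_{\rm loc}(0,\infty)$ and satisfies $$X(t)=x+\int_0^t f(X(s),\alpha(s))\,ds-k(t)\ \text{ for all } t\ge0,\qquad X(t)\in\Gamma\ \text{ for all } t>0,$$ $$X(0^+)=\overline x,\qquad k(0^+)=x-\overline x.$$ (3) If $x\in\Gamma$, then, for every such limit pair, the convergence is locally uniform on $[0,\infty)$ and $(X,k)\in H^1_{\rm loc}[0,\infty)\times H^1_{\rm loc}[0,\infty)$. (4) Every such limit pair belongs to $W^{1,\infty}_{\rm loc}(0,\infty)\times W^{1,\infty}_{\rm loc}(0,\infty)$, and $|\dot X(t)|\le|f|_\infty$ and $|\dot k(t)|\le|f|_\infty$ for a.e. $t\in(0,\infty)$. -/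

import Mathlib

open Set Filter Topology MeasureTheory
open scoped ENNReal ContDiff

noncomputable section

/-- The plane `ℝ²` with its Euclidean structure. -/
abbrev Plane : Type := EuclideanSpace ℝ (Fin 2)

/-- The four cardinal unit vectors `e_E, e_N, e_W, e_S`. -/
def cardinal : Fin 4 → Plane :=
  ![!₂[1, 0], !₂[0, 1], !₂[-1, 0], !₂[0, -1]]

/-- The junction: the origin together with the four open half-lines `(0,∞) e_i`. -/
def network : Set Plane :=
  {0} ∪ ⋃ i : Fin 4, (fun r : ℝ => r • cardinal i) '' Ioi 0

/-- The penalization function `d(x) = x₁² x₂²`. -/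
def pen (x : Plane) : ℝ := x 0 ^ 2 * x 1 ^ 2

/-- `|f|_∞ = sup |f(x,a)|`, Euclidean norm, over all `x` and `a`. -/
def supNorm {A : Type*} (f : Plane → A → Plane) : ℝ :=
  ⨆ p : Plane × A, ‖f p.1 p.2‖

/-- `g` is the weak (distributional) derivative of `u` on the open set `U ⊆ ℝ`. -/
structure HasWeakDerivOn (U : Set ℝ) (u g : ℝ → Plane) : Prop where
  locInt : LocallyIntegrableOn u U
  locInt_deriv : LocallyIntegrableOn g U
  integral_eq : ∀ φ : ℝ → ℝ, ContDiff ℝ ∞ φ → HasCompactSupport φ → tsupport φ ⊆ U →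
    ∫ t, deriv φ t • u t = -∫ t, φ t • g t

/-- `u ∈ W^{1,p}_loc(J)` for an interval `J`: `u` has a weak derivative in the interior of `J`,
and both lie in `L^p([a,b])` for every compact interval `[a,b] ⊆ J`. So `J = (0,∞)` says nothing
about the behaviour at `0`, whereas `J = [0,∞)` gives `W^{1,p}(0,T)` for every `T`. -/
def MemSobolevLoc (p : ℝ≥0∞) (J : Set ℝ) (u : ℝ → Plane) : Prop :=
  ∃ g : ℝ → Plane, HasWeakDerivOn (interior J) u g ∧
    ∀ a b : ℝ, Icc a b ⊆ J →
      MemLp u p (volume.restrict (Icc a b)) ∧ MemLp g p (volume.restrict (Icc a b))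

/-- `X` is (the continuous representative of) a `W^{1,∞}_loc[0,∞)` solution of
`Ẋ = f(X,α) - ε⁻¹ ∇d(X)`, `X(0) = x`. Only the values of `X` on `[0,∞)` matter. -/
structure IsTrajectory {A : Type*} (f : Plane → A → Plane) (α : ℝ → A) (ε : ℝ) (x : Plane)
    (X : ℝ → Plane) : Prop where
  continuousOn : ContinuousOn X (Ici 0)
  initial : X 0 = x
  memSobolev : MemSobolevLoc ∞ (Ici 0) X
  ode : HasWeakDerivOn (Ioi 0) X (fun t => f (X t) (α t) - ε⁻¹ • gradient pen (X t))

/-- `k(t) = ε⁻¹ ∫₀ᵗ ∇d(X(s)) ds`. -/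
def penaltyTerm (ε : ℝ) (X : ℝ → Plane) (t : ℝ) : Plane :=
  ε⁻¹ • ∫ s in (0 : ℝ)..t, gradient pen (X s)

/-- `Z` solves the gradient descent `Ż = -∇d(Z)` on `[0,∞)` with `Z(0) = x`. -/
structure IsGradientFlow (x : Plane) (Z : ℝ → Plane) : Prop where
  initial : Z 0 = x
  ode : ∀ t, 0 ≤ t → HasDerivWithinAt Z (-gradient pen (Z t)) (Ici 0) t

/-- `(X,k)` is the limit of the pairs `(Xs n, ks n)`: locally uniformly on `(0,∞)`, and
pointwise at the initial time `t = 0`. -/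
structure IsLimitPair (Xs ks : ℕ → ℝ → Plane) (X k : ℝ → Plane) : Prop where
  unif_X : TendstoLocallyUniformlyOn Xs X atTop (Ioi 0)
  unif_k : TendstoLocallyUniformlyOn ks k atTop (Ioi 0)
  zero_X : Tendsto (fun n => Xs n 0) atTop (𝓝 (X 0))
  zero_k : Tendsto (fun n => ks n 0) atTop (𝓝 (k 0))

end

/-! Write N for the bound on the drift and p = ε⁻¹∇d(X) for the penalty force. Everything rests on
four estimates that are uniform in ε.

Growth: y·∇d(y) = 4d(y) ≥ 0, so the penalty never pushes outward and |X(t)| ≤ eᵗ(|x|+N). This bound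
makes truncation harmless and gives global existence and uniqueness although ∇d is cubic.

Decay: |∇d|² ≥ 8|x₁x₂|³ = 8d^(3/2). Young's inequality absorbs the drift, and linearizing the
superlinear damping at a free level `lam` turns it into a linear differential inequality for d(X).
The choice `lam` = ε^(2/3) yields ε⁻¹d(X(t)) = O(ε^(1/3)) at each fixed t > 0 (`inv_mul_pen_le`).

Energy: with Ẋ = f - p, one has |Ẋ|² + 2p·Ẋ = |f|² - |p|² and |p|² + 2p·Ẋ = |f|² - |f-p|². Both |Ẋ|²
and |k̇|² are thus at most N² - 2(ε⁻¹d(X))'. Integration and Cauchy–Schwarz bound the squared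
increments of X and k over [s,t] by (t-s)²N² plus 2(t-s) times the drop of ε⁻¹d(X). Away from t = 0
this is equicontinuity, hence compactness; in the limit the energy term vanishes and X and k are
N-Lipschitz on (0,∞), which gives every Sobolev claim with the sharp constant |f|_∞. If x ∈ Γ, the
energy vanishes at t = 0 and the same argument reaches the initial time.

Initial layer: h = x₁² - x₂² is conserved by the penalty, so along X it moves by O(t) uniformly in
ε. A point of Γ is determined by h and the sign of its nonzero coordinate, and that sign cannot
change while h keeps its own. Hence X(0⁺) is the explicit point `flowLimit x`. The gradient descent
is the case of zero drift and ε = 1, so the same estimates show that it tends to the same point.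

The Sobolev formulation is exchanged for integral equations by the lemma of du Bois-Reymond. -/

noncomputable section

/-! ### Planar calculus, the penalization and its zero set -/

/-- An absolutely continuous function with almost everywhere nonpositive derivative does not
increase. -/
theorem AbsolutelyContinuousOnInterval.le_of_ae_hasDerivAt_nonpos {u u' : ℝ → ℝ} {a b : ℝ}
    (hab : a ≤ b) (hu : AbsolutelyContinuousOnInterval u a b)
    (h : ∀ᵐ t, t ∈ Ioo a b → HasDerivAt u (u' t) t ∧ u' t ≤ 0) : u b ≤ u a := by
  have h1 := hu.integral_deriv_eq_sub
  have h2 : ∫ t in a..b, deriv u t ≤ 0 := by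
    have h3 : 0 ≤ ∫ t in a..b, -deriv u t := by
      rw [intervalIntegral.integral_of_le hab, integral_Ioc_eq_integral_Ioo]
      apply setIntegral_nonneg_of_ae_restrict
      filter_upwards [ae_restrict_of_ae h, ae_restrict_mem measurableSet_Ioo] with t ht hm
      have := ht hm
      simp only [Pi.zero_apply]
      rw [this.1.deriv]; linarith [this.2]
    rw [intervalIntegral.integral_neg] at h3
    linarith
  linarith

theorem hasDerivAt_coord {X : ℝ → Plane} {v : Plane} {t : ℝ} (h : HasDerivAt X v t) (i : Fin 2) :
    HasDerivAt (fun s => X s i) (v i) t :=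
  (EuclideanSpace.proj (𝕜 := ℝ) i).hasFDerivAt.comp_hasDerivAt t h

theorem norm_sq_plane (y : Plane) : ‖y‖ ^ 2 = y 0 ^ 2 + y 1 ^ 2 := by
  rw [EuclideanSpace.norm_sq_eq]; simp [Fin.sum_univ_two]

theorem abs_coord_le (y : Plane) (i : Fin 2) : |y i| ≤ ‖y‖ := by
  simpa using PiLp.norm_apply_le y i

theorem norm_le_add_abs (y : Plane) : ‖y‖ ≤ |y 0| + |y 1| := by
  refine abs_le_of_sq_le_sq' ?_ (by positivity) |>.2
  rw [norm_sq_plane]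
  nlinarith [abs_nonneg (y 0), abs_nonneg (y 1), sq_abs (y 0), sq_abs (y 1),
    mul_nonneg (abs_nonneg (y 0)) (abs_nonneg (y 1))]

theorem dot_le_norm_mul_norm (y z : Plane) : y 0 * z 0 + y 1 * z 1 ≤ ‖y‖ * ‖z‖ := by
  have := real_inner_le_norm y z
  simp only [PiLp.inner_apply, Fin.sum_univ_two] at this
  simp at this
  linarith

theorem gradient_pen (y : Plane) : gradient pen y = !₂[2 * y 0 * y 1 ^ 2, 2 * y 0 ^ 2 * y 1] := by
  apply HasGradientAt.gradient
  rw [hasGradientAt_iff_hasFDerivAt]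
  have h0 : HasFDerivAt (fun z : Plane => z 0) (EuclideanSpace.proj (𝕜 := ℝ) (0 : Fin 2)) y :=
    (EuclideanSpace.proj (𝕜 := ℝ) (0 : Fin 2)).hasFDerivAt
  have h1 : HasFDerivAt (fun z : Plane => z 1) (EuclideanSpace.proj (𝕜 := ℝ) (1 : Fin 2)) y :=
    (EuclideanSpace.proj (𝕜 := ℝ) (1 : Fin 2)).hasFDerivAt
  have h := (h0.pow 2).mul (h1.pow 2)
  refine h.congr_fderiv ?_
  ext v
  simp [PiLp.inner_apply, Fin.sum_univ_two]
  ring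

@[simp] theorem gradient_pen_zero_coord (y : Plane) :
    (gradient pen y) 0 = 2 * y 0 * y 1 ^ 2 := by simp [gradient_pen]

@[simp] theorem gradient_pen_one_coord (y : Plane) :
    (gradient pen y) 1 = 2 * y 0 ^ 2 * y 1 := by simp [gradient_pen]

theorem continuous_coord (i : Fin 2) : Continuous (fun y : Plane => y i) :=
  (EuclideanSpace.proj (𝕜 := ℝ) i).continuous

theorem continuous_pen : Continuous pen := by
  unfold pen
  exact ((continuous_coord 0).pow 2).mul ((continuous_coord 1).pow 2)

theorem continuous_gradient_pen : Continuous (gradient pen) := by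
  have h0 := continuous_coord 0
  have h1 := continuous_coord 1
  have : gradient pen = fun y => WithLp.toLp 2 ![2 * y 0 * y 1 ^ 2, 2 * y 0 ^ 2 * y 1] :=
    funext gradient_pen
  rw [this]
  refine (PiLp.continuous_toLp 2 _).comp (continuous_pi fun i => ?_)
  fin_cases i
  · exact (continuous_const.mul h0).mul (h1.pow 2)
  · exact (continuous_const.mul (h0.pow 2)).mul h1

theorem pen_nonneg (y : Plane) : 0 ≤ pen y := by unfold pen; positivity

theorem norm_gradient_pen_sub_le {R : ℝ} {y z : Plane} (hy : ∀ i, |y i| ≤ R)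
    (hz : ∀ i, |z i| ≤ R) :
    ‖gradient pen y - gradient pen z‖ ≤ 12 * R ^ 2 * ‖y - z‖ := by
  -- Up to swapping the coordinates, both components of the gradient have the form 2pq², so one
  -- cubic estimate serves for both.
  have key : ∀ p q p' q' D : ℝ, |p| ≤ R → |q| ≤ R → |p'| ≤ R → |q'| ≤ R → |p - p'| ≤ D →
      |q - q'| ≤ D → |2 * p * q ^ 2 - 2 * p' * q' ^ 2| ≤ 6 * R ^ 2 * D := by
    intro p q p' q' D hp hq hp' hq' h1 h2
    have hR : 0 ≤ R := (abs_nonneg _).trans hp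
    have hD : 0 ≤ D := (abs_nonneg _).trans h1
    have e : 2 * p * q ^ 2 - 2 * p' * q' ^ 2 =
        2 * (p - p') * q ^ 2 + (2 * p' * q * (q - q') + 2 * p' * q' * (q - q')) := by ring
    rw [e]
    have a1 : |2 * (p - p') * q ^ 2| ≤ 2 * D * R ^ 2 := by
      rw [abs_mul, abs_mul, abs_two, abs_pow]; gcongr
    have a2 : |2 * p' * q * (q - q')| ≤ 2 * R * R * D := by
      rw [abs_mul, abs_mul, abs_mul, abs_two]; gcongr
    have a3 : |2 * p' * q' * (q - q')| ≤ 2 * R * R * D := by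
      rw [abs_mul, abs_mul, abs_mul, abs_two]; gcongr
    refine (abs_add_le _ _).trans ((add_le_add a1 ((abs_add_le _ _).trans (add_le_add a2 a3))).trans ?_)
    exact le_of_eq (by ring)
  have d0 : |y 0 - z 0| ≤ ‖y - z‖ := by simpa using abs_coord_le (y - z) 0
  have d1 : |y 1 - z 1| ≤ ‖y - z‖ := by simpa using abs_coord_le (y - z) 1
  refine (norm_le_add_abs _).trans ?_
  have k0 := key _ _ _ _ _ (hy 0) (hy 1) (hz 0) (hz 1) d0 d1
  have k1 := key _ _ _ _ _ (hy 1) (hy 0) (hz 1) (hz 0) d1 d0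
  have e1 : 2 * y 0 ^ 2 * y 1 - 2 * z 0 ^ 2 * z 1 = 2 * y 1 * y 0 ^ 2 - 2 * z 1 * z 0 ^ 2 := by
    ring
  simp only [PiLp.sub_apply, gradient_pen_zero_coord, gradient_pen_one_coord]
  rw [e1]
  linarith

theorem dot_gradient_pen (y : Plane) :
    y 0 * gradient pen y 0 + y 1 * gradient pen y 1 = 4 * pen y := by
  simp [pen]; ring

theorem norm_sq_gradient_pen (y : Plane) :
    ‖gradient pen y‖ ^ 2 = 4 * pen y * ‖y‖ ^ 2 := by
  rw [norm_sq_plane, norm_sq_plane]; simp [pen]; ring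

theorem mem_network_iff (y : Plane) : y ∈ network ↔ pen y = 0 := by
  have hc : ∀ (r : ℝ) (i : Fin 4), pen (r • cardinal i) = 0 := by
    intro r i; fin_cases i <;> simp [pen, cardinal]
  constructor
  · rintro (h | h)
    · rw [mem_singleton_iff.1 h]; simp [pen]
    · obtain ⟨i, r, -, rfl⟩ := mem_iUnion.1 h
      exact hc r i
  · intro h
    have h' : y 0 = 0 ∨ y 1 = 0 := by simpa [pen] using h
    have mk : ∀ (i : Fin 4) (r : ℝ), 0 < r → r • cardinal i = y → y ∈ network := fun i r hr e =>
      Or.inr (mem_iUnion.2 ⟨i, r, hr, e⟩)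
    rcases h' with h0 | h1
    · rcases lt_trichotomy (y 1) 0 with hy | hy | hy
      · refine mk 3 (-y 1) (by simpa using hy) ?_
        ext i; fin_cases i <;> simp [cardinal, h0]
      · left; ext i; fin_cases i <;> simp [h0, hy]
      · refine mk 1 (y 1) hy ?_
        ext i; fin_cases i <;> simp [cardinal, h0]
    · rcases lt_trichotomy (y 0) 0 with hy | hy | hy
      · refine mk 2 (-y 0) (by simpa using hy) ?_
        ext i; fin_cases i <;> simp [cardinal, h1]
      · left; ext i; fin_cases i <;> simp [h1, hy]
      · refine mk 0 (y 0) hy ?_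
        ext i; fin_cases i <;> simp [cardinal, h1]

/-! ### Carathéodory existence by a weighted contraction -/

/-- Carathéodory's theorem for a field `G` with a continuous time dependent Lipschitz bound `K`. -/
theorem exists_integral_eq_of_lipschitz (G : ℝ → Plane → Plane) (K : ℝ → ℝ) (hK : Continuous K)
    (hK0 : ∀ s, 0 ≤ K s) (hlip : ∀ s y z, ‖G s y - G s z‖ ≤ K s * ‖y - z‖)
    (hzero : ∀ s, ‖G s 0‖ ≤ K s)
    (hmeas : ∀ Y : ℝ → Plane, Continuous Y → AEStronglyMeasurable (fun s => G s (Y s)) volume)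
    (x : Plane) :
    ∃ X : ℝ → Plane, Continuous X ∧ (∀ a b, IntervalIntegrable (fun s => G s (X s)) volume a b) ∧
      ∀ t, 0 ≤ t → X t = x + ∫ s in (0 : ℝ)..t, G s (X s) := by
  set κ : ℝ → ℝ := fun t => ∫ s in (0 : ℝ)..t, K s with hκ
  have hκd : ∀ t, HasDerivAt κ (K t) t := fun t =>
    intervalIntegral.integral_hasDerivAt_right (hK.intervalIntegrable _ _)
      (hK.stronglyMeasurableAtFilter _ _) hK.continuousAt
  have hκc : Continuous κ := continuous_iff_continuousAt.2 fun t => (hκd t).continuousAt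
  have hκ0 : κ 0 = 0 := by simp [hκ]
  -- Bielecki weight: the fixed point is sought as X/E, and the factor 2 in the exponent makes the
  -- Picard map contract by 1/2 on the whole half-line at once.
  set E : ℝ → ℝ := fun t => Real.exp (2 * κ t) with hE
  have hEc : Continuous E := Real.continuous_exp.comp (continuous_const.mul hκc)
  have hEint : ∀ t, ∫ s in (0 : ℝ)..t, K s * E s = (E t - 1) / 2 := by
    intro t
    have : ∀ s ∈ uIcc 0 t, HasDerivAt (fun s => E s / 2) (K s * E s) s := by
      intro s _
      refine ((((hκd s).const_mul 2).exp).div_const 2).congr_deriv ?_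
      simp only [hE]; ring
    rw [intervalIntegral.integral_eq_sub_of_hasDerivAt this
      ((hK.mul hEc).intervalIntegrable _ _)]
    simp [hE, hκ0]; ring
  have hE0 : ∀ t, 0 < E t := fun t => Real.exp_pos _
  have hE1 : ∀ t, 0 ≤ t → 1 ≤ E t := fun t ht => by
    have : 0 ≤ κ t := intervalIntegral.integral_nonneg ht fun s _ => hK0 s
    exact Real.one_le_exp (by linarith)
  have hgrow : ∀ s y, ‖G s y‖ ≤ K s * (1 + ‖y‖) := by
    intro s y
    have h1 := hlip s y 0
    have h2 : ‖G s y‖ ≤ ‖G s y - G s 0‖ + ‖G s 0‖ := by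
      simpa using norm_add_le (G s y - G s 0) (G s 0)
    rw [sub_zero] at h1
    linarith [hzero s]
  have hint : ∀ Y : ℝ → Plane, Continuous Y → ∀ a b,
      IntervalIntegrable (fun s => G s (Y s)) volume a b := by
    intro Y hY a b
    refine IntervalIntegrable.mono_fun' (g := fun s => K s * (1 + ‖Y s‖)) ?_
      (hmeas Y hY).restrict (Eventually.of_forall fun s => hgrow s _)
    exact (hK.mul (continuous_const.add hY.norm)).intervalIntegrable _ _
  have hEY : ∀ Y : BoundedContinuousFunction ℝ Plane, Continuous (fun s => E s • Y s) :=
    fun Y => hEc.smul Y.continuous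
  set I : BoundedContinuousFunction ℝ Plane → ℝ → Plane := fun Y t =>
    (E (max t 0))⁻¹ • (x + ∫ s in (0 : ℝ)..(max t 0), G s (E s • Y s)) with hI
  have hIc : ∀ Y, Continuous (I Y) := by
    intro Y
    have hm : Continuous fun t : ℝ => max t 0 := continuous_id.max continuous_const
    refine ((hEc.comp hm).inv₀ fun t => (hE0 _).ne').smul (continuous_const.add ?_)
    exact (intervalIntegral.continuous_primitive (hint _ (hEY Y)) 0).comp hm
  have hIb : ∀ Y t, ‖I Y t‖ ≤ ‖x‖ + (1 + ‖Y‖) / 2 := by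
    intro Y t
    set τ := max t 0
    have hτ : 0 ≤ τ := le_max_right _ _
    have h1 : ‖∫ s in (0 : ℝ)..τ, G s (E s • Y s)‖ ≤ ∫ s in (0 : ℝ)..τ, (1 + ‖Y‖) * (K s * E s) := by
      refine intervalIntegral.norm_integral_le_of_norm_le hτ (Eventually.of_forall fun s hs => ?_)
        ((continuous_const.mul (hK.mul hEc)).intervalIntegrable _ _)
      refine (hgrow s _).trans ?_
      rw [norm_smul, Real.norm_of_nonneg (hE0 s).le]
      have h2 := Y.norm_coe_le_norm s
      have h3 := hE1 s hs.1.le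
      have h4 : 1 + E s * ‖Y s‖ ≤ (1 + ‖Y‖) * E s := by nlinarith
      calc _ ≤ K s * ((1 + ‖Y‖) * E s) := mul_le_mul_of_nonneg_left h4 (hK0 s)
        _ = _ := by ring
    rw [intervalIntegral.integral_const_mul, hEint] at h1
    have h5 : ‖I Y t‖ ≤ (E τ)⁻¹ * (‖x‖ + (1 + ‖Y‖) * ((E τ - 1) / 2)) := by
      simp only [hI]
      rw [norm_smul, Real.norm_of_nonneg (inv_nonneg.2 (hE0 _).le)]
      exact mul_le_mul_of_nonneg_left ((norm_add_le _ _).trans (by linarith))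
        (inv_nonneg.2 (hE0 _).le)
    refine h5.trans ?_
    rw [inv_mul_le_iff₀ (hE0 τ)]
    nlinarith [hE1 τ hτ, norm_nonneg x, norm_nonneg Y]
  set Φ : BoundedContinuousFunction ℝ Plane → BoundedContinuousFunction ℝ Plane := fun Y =>
    BoundedContinuousFunction.ofNormedAddCommGroup (I Y) (hIc Y) _ (hIb Y) with hΦ
  have hcontr : ContractingWith (1 / 2 : NNReal) Φ := by
    refine ⟨by norm_num, LipschitzWith.of_dist_le_mul fun Y Y' => ?_⟩
    rw [BoundedContinuousFunction.dist_le (by positivity)]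
    intro t
    change dist (I Y t) (I Y' t) ≤ _
    set τ := max t 0
    have hτ : 0 ≤ τ := le_max_right _ _
    have e : I Y t - I Y' t =
        (E τ)⁻¹ • ∫ s in (0 : ℝ)..τ, (G s (E s • Y s) - G s (E s • Y' s)) := by
      rw [intervalIntegral.integral_sub (hint _ (hEY Y) _ _) (hint _ (hEY Y') _ _)]
      simp only [hI]
      rw [← smul_sub]; congr 1; abel
    have h1 : ‖∫ s in (0 : ℝ)..τ, (G s (E s • Y s) - G s (E s • Y' s))‖ ≤
        ∫ s in (0 : ℝ)..τ, dist Y Y' * (K s * E s) := by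
      refine intervalIntegral.norm_integral_le_of_norm_le hτ (Eventually.of_forall fun s hs => ?_)
        ((continuous_const.mul (hK.mul hEc)).intervalIntegrable _ _)
      refine (hlip s _ _).trans ?_
      rw [← smul_sub, norm_smul, Real.norm_of_nonneg (hE0 s).le, ← dist_eq_norm]
      have h2 := BoundedContinuousFunction.dist_coe_le_dist (f := Y) (g := Y') s
      calc K s * (E s * dist (Y s) (Y' s)) ≤ K s * (E s * dist Y Y') :=
            mul_le_mul_of_nonneg_left (mul_le_mul_of_nonneg_left h2 (hE0 s).le) (hK0 s)
        _ = _ := by ring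
    rw [intervalIntegral.integral_const_mul, hEint] at h1
    rw [dist_eq_norm, e, norm_smul, Real.norm_of_nonneg (inv_nonneg.2 (hE0 _).le),
      inv_mul_le_iff₀ (hE0 τ)]
    refine h1.trans ?_
    have := dist_nonneg (x := Y) (y := Y')
    push_cast
    nlinarith [hE1 τ hτ]
  obtain ⟨Y, hY, -⟩ := hcontr.exists_fixedPoint 0 (edist_ne_top _ _)
  have hYI : ∀ t, I Y t = Y t := fun t => by
    have := congrArg (fun Z : BoundedContinuousFunction ℝ Plane => Z t) hY
    exact this
  refine ⟨fun s => E s • Y s, hEY Y, hint _ (hEY Y), fun t ht => ?_⟩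
  have := hYI t
  simp only [hI, max_eq_left ht] at this
  simp only
  rw [← this, smul_smul, mul_inv_cancel₀ (hE0 t).ne', one_smul]

/-! ### Paths with an integrable rate -/

theorem AbsolutelyContinuousOnInterval.congr {u v : ℝ → ℝ} {a b : ℝ}
    (hu : AbsolutelyContinuousOnInterval u a b) (h : EqOn u v (uIcc a b)) :
    AbsolutelyContinuousOnInterval v a b := by
  rw [absolutelyContinuousOnInterval_iff] at hu ⊢
  intro ε hε
  obtain ⟨δ, hδ, H⟩ := hu ε hε
  refine ⟨δ, hδ, fun E hE hs => ?_⟩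
  have := H E hE hs
  convert this using 1
  refine Finset.sum_congr rfl fun i hi => ?_
  rw [h (hE.1 i hi).1, h (hE.1 i hi).2]

/-- `X` is the primitive of `w` on `[0,∞)` starting at `X 0`. -/
structure HasRate (w X : ℝ → Plane) : Prop where
  integrable : ∀ a b : ℝ, 0 ≤ a → 0 ≤ b → IntervalIntegrable w volume a b
  eq : ∀ t : ℝ, 0 ≤ t → X t = X 0 + ∫ s in (0 : ℝ)..t, w s

namespace HasRate

variable {w X : ℝ → Plane}

theorem sub_eq (h : HasRate w X) {s t : ℝ} (hs : 0 ≤ s) (ht : 0 ≤ t) :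
    X t - X s = ∫ r in s..t, w r := by
  rw [h.eq t ht, h.eq s hs, ← intervalIntegral.integral_interval_sub_left
    (h.integrable 0 t le_rfl ht) (h.integrable 0 s le_rfl hs)]
  abel

theorem absolutelyContinuous (h : HasRate w X) {a b : ℝ} (ha : 0 ≤ a) (hb : 0 ≤ b) (i : Fin 2) :
    AbsolutelyContinuousOnInterval (fun t => X t i) a b := by
  have hw : IntervalIntegrable (fun s => w s i) volume a b := by
    have := h.integrable a b ha hb
    rw [intervalIntegrable_iff] at this ⊢
    exact (EuclideanSpace.proj (𝕜 := ℝ) i).integrable_comp this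
  have h1 := hw.absolutelyContinuousOnInterval_intervalIntegral (c := a) left_mem_uIcc
  have h2 : AbsolutelyContinuousOnInterval (fun _ : ℝ => X a i) a b :=
    (LipschitzWith.const (X a i)).lipschitzOnWith.absolutelyContinuousOnInterval
  refine (h2.add h1).congr fun t ht => ?_
  have ht0 : 0 ≤ t := (le_min ha hb).trans ht.1
  have h3 : ∫ v in a..t, w v i = (∫ v in a..t, w v) i :=
    (EuclideanSpace.proj (𝕜 := ℝ) i).intervalIntegral_comp_comm (h.integrable a t ha ht0)
  simp only [Pi.add_apply]
  rw [h3, ← h.sub_eq ha ht0]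
  simp

theorem ae_hasDerivAt (h : HasRate w X) : ∀ᵐ t, 0 < t → HasDerivAt X (w t) t := by
  have h1 : ∀ n : ℕ, ∀ᵐ t, t ∈ Ioo (0 : ℝ) n → HasDerivAt X (w t) t := by
    intro n
    have hn : (0 : ℝ) ≤ n := Nat.cast_nonneg n
    filter_upwards [(h.integrable 0 n le_rfl hn).ae_hasDerivAt_integral] with t ht hm
    rw [uIcc_of_le hn] at ht
    have := (ht ⟨hm.1.le, hm.2.le⟩ 0 ⟨le_rfl, hn⟩).const_add (X 0)
    refine this.congr_of_eventuallyEq ?_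
    filter_upwards [lt_mem_nhds hm.1] with r hr
    exact h.eq r hr.le
  filter_upwards [ae_all_iff.2 h1] with t ht h0
  obtain ⟨n, hn⟩ := exists_nat_gt t
  exact ht n ⟨h0, hn⟩

theorem continuousOn (h : HasRate w X) : ContinuousOn X (Ici 0) := by
  intro t ht
  have ht : (0 : ℝ) ≤ t := ht
  have h1 : ContinuousOn (fun s => X 0 + ∫ r in (0 : ℝ)..s, w r) (uIcc 0 (t + 1)) :=
    continuousOn_const.add (intervalIntegral.continuousOn_primitive_interval
      ((intervalIntegrable_iff' (by simp)).1 (h.integrable 0 (t + 1) le_rfl (by linarith))))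
  rw [uIcc_of_le (by linarith)] at h1
  have h2 : ContinuousOn X (Icc 0 (t + 1)) := h1.congr fun s hs => h.eq s hs.1
  refine (h2 t ⟨ht, by linarith⟩).mono_of_mem_nhdsWithin ?_
  filter_upwards [self_mem_nhdsWithin, nhdsWithin_le_nhds (gt_mem_nhds (lt_add_one t))] with s h h'
  exact ⟨h, le_of_lt h'⟩

/-- Comparison principle for a function of time that is absolutely continuous along `X`. -/
theorem le_of_ae (h : HasRate w X) {u u' : ℝ → ℝ} {a b : ℝ} (ha : 0 ≤ a) (hab : a ≤ b)
    (hu : AbsolutelyContinuousOnInterval u a b)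
    (hd : ∀ t, 0 < t → HasDerivAt X (w t) t → HasDerivAt u (u' t) t)
    (hn : ∀ t, t ∈ Ioo a b → u' t ≤ 0) : u b ≤ u a := by
  refine AbsolutelyContinuousOnInterval.le_of_ae_hasDerivAt_nonpos hab hu (u' := u') ?_
  filter_upwards [h.ae_hasDerivAt] with t ht hm
  have h0 : 0 < t := lt_of_le_of_lt ha hm.1
  exact ⟨hd t h0 (ht h0), hn t hm⟩

end HasRate

theorem ContDiff.absolutelyContinuous {u : ℝ → ℝ} (hu : ContDiff ℝ 1 u) (a b : ℝ) :
    AbsolutelyContinuousOnInterval u a b :=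
  hu.contDiffOn.absolutelyContinuousOnInterval

/-- The weighted quantity e^(-s)(|X|² + N²) does not increase, because 2X·w ≤ 2N|X| ≤ |X|² + N².
Only the radial part of the rate is controlled, so an inward force of any size is allowed. -/
theorem HasRate.norm_le {w X : ℝ → Plane} (h : HasRate w X) {N : ℝ} (hN : 0 ≤ N)
    (hw : ∀ t, 0 < t → X t 0 * w t 0 + X t 1 * w t 1 ≤ N * ‖X t‖) {t : ℝ} (ht : 0 ≤ t) :
    ‖X t‖ ≤ Real.exp t * (‖X 0‖ + N) := by
  have key := h.le_of_ae (a := 0) (b := t) le_rfl ht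
    (u := fun s => Real.exp (-s) * (X s 0 * X s 0 + X s 1 * X s 1 + N ^ 2))
    (u' := fun s => Real.exp (-s) * (2 * (X s 0 * w s 0 + X s 1 * w s 1)
      - (X s 0 * X s 0 + X s 1 * X s 1 + N ^ 2)))
    (by
      have e : AbsolutelyContinuousOnInterval (fun s : ℝ => Real.exp (-s)) 0 t :=
        ContDiff.absolutelyContinuous (by fun_prop) _ _
      have c : AbsolutelyContinuousOnInterval (fun _ : ℝ => N ^ 2) 0 t :=
        ContDiff.absolutelyContinuous (by fun_prop) _ _
      have p := h.absolutelyContinuous le_rfl ht 0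
      have q := h.absolutelyContinuous le_rfl ht 1
      exact e.mul (((p.mul p).add (q.mul q)).add c))
    (by
      intro s _ hs
      have p := hasDerivAt_coord hs 0
      have q := hasDerivAt_coord hs 1
      refine ((hasDerivAt_neg s).exp.mul (((p.mul p).add (q.mul q)).add_const (N ^ 2))).congr_deriv
        ?_
      simp only [Pi.add_apply, Pi.mul_apply]
      ring)
    (by
      intro s hs
      have h1 := hw s hs.1
      have h2 := norm_sq_plane (X s)
      apply mul_nonpos_of_nonneg_of_nonpos (Real.exp_pos _).le
      nlinarith [sq_nonneg (‖X s‖ - N)])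
  have h2 := norm_sq_plane (X t)
  have h3 := norm_sq_plane (X 0)
  simp only [neg_zero, Real.exp_zero, one_mul] at key
  have h4 : ‖X t‖ ^ 2 + N ^ 2 ≤ Real.exp t * (‖X 0‖ ^ 2 + N ^ 2) := by
    have := mul_le_mul_of_nonneg_left key (Real.exp_pos t).le
    rw [← mul_assoc, ← Real.exp_add] at this
    simp only [add_neg_cancel, Real.exp_zero, one_mul] at this
    rw [h2, h3]
    simpa only [sq] using this
  have h5 : 1 ≤ Real.exp t := Real.one_le_exp ht
  have h0 := norm_nonneg (X 0)
  refine abs_le_of_sq_le_sq' ?_ (by positivity) |>.2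
  have h6 : Real.exp t * (‖X 0‖ ^ 2 + N ^ 2) ≤ Real.exp t ^ 2 * (‖X 0‖ + N) ^ 2 := by
    apply mul_le_mul
    · nlinarith
    · nlinarith [mul_nonneg h0 hN]
    · positivity
    · positivity
  nlinarith [sq_nonneg N]

/-! ### Well-posedness of the penalized equation -/

/-- A bounded Lipschitz drift that is measurable along continuous paths. -/
structure IsDrift (N L : ℝ) (g : ℝ → Plane → Plane) : Prop where
  norm_le : ∀ s y, ‖g s y‖ ≤ N
  lip : ∀ s y z, ‖g s y - g s z‖ ≤ L * ‖y - z‖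
  meas : ∀ Y : ℝ → Plane, ContinuousOn Y (Ioi 0) →
    AEStronglyMeasurable (fun s => g s (Y s)) (volume.restrict (Ioi 0))

theorem IsDrift.nonneg {N L : ℝ} {g : ℝ → Plane → Plane} (hg : IsDrift N L g) : 0 ≤ N :=
  (norm_nonneg _).trans (hg.norm_le 0 0)

theorem IsDrift.intervalIntegrable {N L : ℝ} {g : ℝ → Plane → Plane} (hg : IsDrift N L g)
    {Y : ℝ → Plane} (hY : ContinuousOn Y (Ioi 0)) {a b : ℝ} (ha : 0 ≤ a) (hb : 0 ≤ b) :
    IntervalIntegrable (fun s => g s (Y s)) volume a b := by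
  rw [intervalIntegrable_iff]
  have hsub : uIoc a b ⊆ Ioi 0 := fun s hs => lt_of_le_of_lt (le_min ha hb) hs.1
  have : IsFiniteMeasure (volume.restrict (uIoc a b)) := by unfold uIoc; infer_instance
  exact Integrable.of_bound ((hg.meas Y hY).mono_set hsub) N
    (Eventually.of_forall fun s => hg.norm_le s _)

/-- The right-hand side `g(s,X) - ε⁻¹ ∇d(X)` along a path. -/
def velocity (g : ℝ → Plane → Plane) (ε : ℝ) (X : ℝ → Plane) (s : ℝ) : Plane :=
  g s (X s) - ε⁻¹ • gradient pen (X s)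

/-- Integral solutions of `Ẋ = g(t,X) - ε⁻¹ ∇d(X)`, `X(0) = x`. -/
structure IsMildSolution (g : ℝ → Plane → Plane) (ε : ℝ) (x : Plane) (X : ℝ → Plane) : Prop where
  initial : X 0 = x
  rate : HasRate (velocity g ε X) X

theorem intervalIntegrable_gradient_pen {X : ℝ → Plane} (hX : ContinuousOn X (Ici 0)) {a b : ℝ}
    (ha : 0 ≤ a) (hb : 0 ≤ b) : IntervalIntegrable (fun s => gradient pen (X s)) volume a b :=
  (continuous_gradient_pen.comp_continuousOn
    (hX.mono fun _ hs => (le_min ha hb).trans hs.1)).intervalIntegrable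

theorem IsDrift.intervalIntegrable_velocity {N L : ℝ} {g : ℝ → Plane → Plane}
    (hg : IsDrift N L g) {X : ℝ → Plane} (hX : ContinuousOn X (Ici 0)) (ε : ℝ) {a b : ℝ}
    (ha : 0 ≤ a) (hb : 0 ≤ b) : IntervalIntegrable (velocity g ε X) volume a b :=
  (hg.intervalIntegrable (hX.mono Ioi_subset_Ici_self) ha hb).sub
    ((intervalIntegrable_gradient_pen hX ha hb).smul ε⁻¹)

theorem IsMildSolution.of_integral_eq {N L : ℝ} {g : ℝ → Plane → Plane} (hg : IsDrift N L g)
    {ε : ℝ} {x : Plane} {X : ℝ → Plane} (hX : ContinuousOn X (Ici 0))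
    (h : ∀ t, 0 ≤ t → X t = x + ∫ s in (0 : ℝ)..t, velocity g ε X s) : IsMildSolution g ε x X := by
  have h0 : X 0 = x := by simpa using h 0 le_rfl
  exact ⟨h0, fun _ _ ha hb => hg.intervalIntegrable_velocity hX ε ha hb, by rwa [h0]⟩

theorem drift_dot_le {N L : ℝ} {g : ℝ → Plane → Plane} (hg : IsDrift N L g) (s : ℝ) (y : Plane) :
    y 0 * g s y 0 + y 1 * g s y 1 ≤ N * ‖y‖ :=
  (dot_le_norm_mul_norm _ _).trans (by
    rw [mul_comm]; exact mul_le_mul_of_nonneg_right (hg.norm_le _ _) (norm_nonneg _))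

theorem IsMildSolution.norm_le {N L : ℝ} {g : ℝ → Plane → Plane} (hg : IsDrift N L g)
    {ε : ℝ} (hε : 0 < ε) {x : Plane} {X : ℝ → Plane} (h : IsMildSolution g ε x X) {t : ℝ}
    (ht : 0 ≤ t) : ‖X t‖ ≤ Real.exp t * (‖x‖ + N) := by
  rw [← h.initial]
  refine h.rate.norm_le hg.nonneg (fun s _ => ?_) ht
  have h1 := drift_dot_le hg s (X s)
  have h2 := dot_gradient_pen (X s)
  have h3 := pen_nonneg (X s)
  have h4 : 0 ≤ ε⁻¹ * (4 * pen (X s)) := by positivity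
  rw [← h2] at h4
  simp only [velocity, PiLp.sub_apply, PiLp.smul_apply, smul_eq_mul]
  linarith

/-- Projection of a number to `[-R, R]`. -/
def clamp (R r : ℝ) : ℝ := max (-R) (min r R)

theorem abs_clamp_le {R : ℝ} (hR : 0 ≤ R) (r : ℝ) : |clamp R r| ≤ R :=
  abs_le.2 ⟨le_max_left _ _, max_le (by linarith) (min_le_right _ _)⟩

theorem clamp_of_abs_le {R r : ℝ} (h : |r| ≤ R) : clamp R r = r := by
  rw [abs_le] at h
  simp [clamp, h.1, h.2]

theorem abs_clamp_sub_le (R r r' : ℝ) : |clamp R r - clamp R r'| ≤ |r - r'| := by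
  refine (abs_max_sub_max_le_max _ _ _ _).trans (max_le (by simp) ?_)
  refine (abs_min_sub_min_le_max _ _ _ _).trans (max_le le_rfl (by simp))

theorem mul_clamp_nonneg {R : ℝ} (hR : 0 ≤ R) (r : ℝ) : 0 ≤ r * clamp R r := by
  rcases le_total 0 r with h | h
  · exact mul_nonneg h (le_max_of_le_right (le_min h hR))
  · exact mul_nonneg_of_nonpos_of_nonpos h (max_le (by linarith) ((min_le_left _ _).trans h))

/-- Projection of the plane to the square `[-R, R]²`. -/
def clampPlane (R : ℝ) (y : Plane) : Plane := !₂[clamp R (y 0), clamp R (y 1)]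

theorem norm_clampPlane_sub_le (R : ℝ) (y z : Plane) :
    ‖clampPlane R y - clampPlane R z‖ ≤ ‖y - z‖ := by
  refine abs_le_of_sq_le_sq' ?_ (norm_nonneg _) |>.2
  rw [norm_sq_plane, norm_sq_plane]
  simp only [clampPlane, PiLp.sub_apply]
  exact add_le_add (sq_le_sq.2 (by simpa using abs_clamp_sub_le R (y 0) (z 0)))
    (sq_le_sq.2 (by simpa using abs_clamp_sub_le R (y 1) (z 1)))

theorem abs_clampPlane_le {R : ℝ} (hR : 0 ≤ R) (y : Plane) (i : Fin 2) : |clampPlane R y i| ≤ R := by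
  fin_cases i <;> exact abs_clamp_le hR _

theorem clampPlane_of_norm_le {R : ℝ} {y : Plane} (h : ‖y‖ ≤ R) : clampPlane R y = y := by
  ext i
  have := clamp_of_abs_le ((abs_coord_le y i).trans h)
  fin_cases i <;> simpa [clampPlane] using this

theorem dot_gradient_pen_clampPlane_nonneg {R : ℝ} (hR : 0 ≤ R) (y : Plane) :
    0 ≤ y 0 * gradient pen (clampPlane R y) 0 + y 1 * gradient pen (clampPlane R y) 1 := by
  have h0 := mul_clamp_nonneg hR (y 0)
  have h1 := mul_clamp_nonneg hR (y 1)
  simp only [gradient_pen_zero_coord, gradient_pen_one_coord, clampPlane]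
  simp
  nlinarith [mul_nonneg h0 (sq_nonneg (clamp R (y 1))), mul_nonneg h1 (sq_nonneg (clamp R (y 0)))]

theorem continuous_gradient_pen_clampPlane {R : ℝ → ℝ} (hR : Continuous R) {Y : ℝ → Plane}
    (hY : Continuous Y) : Continuous fun s => gradient pen (clampPlane (R s) (Y s)) := by
  refine continuous_gradient_pen.comp ((PiLp.continuous_toLp 2 _).comp (continuous_pi fun i => ?_))
  have h0 := (continuous_coord 0).comp hY
  have h1 := (continuous_coord 1).comp hY
  fin_cases i
  · exact hR.neg.max (h0.min hR)
  · exact hR.neg.max (h1.min hR)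

theorem exists_isMildSolution {N L : ℝ} {g : ℝ → Plane → Plane} (hg : IsDrift N L g) {ε : ℝ}
    (hε : 0 < ε) (x : Plane) : ∃ X, IsMildSolution g ε x X := by
  have hN := hg.nonneg
  set R : ℝ → ℝ := fun s => Real.exp s * (‖x‖ + N) with hR
  have hR0 : ∀ s, 0 ≤ R s := fun s => by positivity
  have hRc : Continuous R := by fun_prop
  have hc : 0 < ε⁻¹ := inv_pos.2 hε
  -- The argument of ∇d is clamped to a square whose half-width is the a priori bound, which makes
  -- the field globally Lipschitz in space. The indicator is needed because the drift is measurable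
  -- only along positive times.
  set G : ℝ → Plane → Plane := fun s y =>
    (Ioi 0).indicator (fun s => g s y - ε⁻¹ • gradient pen (clampPlane (R s) y)) s with hG
  set K : ℝ → ℝ := fun s => |L| + N + ε⁻¹ * (12 * R s ^ 2) with hK
  have hK0 : ∀ s, 0 ≤ K s := fun s => by positivity
  obtain ⟨X, hXc, hXi, hX⟩ := exists_integral_eq_of_lipschitz G K (by fun_prop) hK0
    (by
      intro s y z
      by_cases hs : s ∈ Ioi (0 : ℝ)
      · simp only [hG, indicator_of_mem hs]
        have h1 := hg.lip s y z
        have h2 := norm_gradient_pen_sub_le (abs_clampPlane_le (hR0 s) y)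
          (abs_clampPlane_le (hR0 s) z)
        have h3 := norm_clampPlane_sub_le (R s) y z
        have e : g s y - ε⁻¹ • gradient pen (clampPlane (R s) y) -
            (g s z - ε⁻¹ • gradient pen (clampPlane (R s) z)) = (g s y - g s z) -
            ε⁻¹ • (gradient pen (clampPlane (R s) y) - gradient pen (clampPlane (R s) z)) := by
          rw [smul_sub]; abel
        rw [e]
        refine (norm_sub_le _ _).trans ?_
        rw [norm_smul, Real.norm_of_nonneg hc.le]
        have h4 := h2.trans (mul_le_mul_of_nonneg_left h3 (by positivity))
        have h5 := mul_le_mul_of_nonneg_left h4 hc.le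
        have h6 := mul_le_mul_of_nonneg_right (le_abs_self L) (norm_nonneg (y - z))
        have h7 := mul_nonneg hN (norm_nonneg (y - z))
        simp only [hK]
        linarith
      · simp only [hG, indicator_of_notMem hs]
        simpa using mul_nonneg (hK0 s) (norm_nonneg (y - z)))
    (by
      intro s
      by_cases hs : s ∈ Ioi (0 : ℝ)
      · simp only [hG, indicator_of_mem hs]
        have : gradient pen (clampPlane (R s) 0) = 0 := by
          rw [clampPlane_of_norm_le (by simpa using hR0 s), gradient_pen]
          ext i; fin_cases i <;> simp
        rw [this, smul_zero, sub_zero]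
        refine (hg.norm_le s 0).trans ?_
        have : 0 ≤ |L| + ε⁻¹ * (12 * R s ^ 2) := by positivity
        simp only [hK]; linarith
      · simp only [hG, indicator_of_notMem hs]
        simpa using hK0 s)
    (by
      intro Y hY
      have e : (fun s => G s (Y s)) = (Ioi 0).indicator
          (fun s => g s (Y s) - ε⁻¹ • gradient pen (clampPlane (R s) (Y s))) := by
        ext1 s; simp only [hG, indicator]
      rw [e, aestronglyMeasurable_indicator_iff measurableSet_Ioi]
      exact (hg.meas Y hY.continuousOn).sub
        ((continuous_gradient_pen_clampPlane hRc hY).const_smul ε⁻¹).aestronglyMeasurable) x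
  have hX0 : X 0 = x := by simpa using hX 0 le_rfl
  have hrate : HasRate (fun s => G s (X s)) X := ⟨fun a b _ _ => hXi a b, by rwa [hX0]⟩
  -- Clamping each coordinate keeps its sign, so the truncated penalty still points inward; the
  -- growth bound holds and the truncation is never active.
  have hb : ∀ t, 0 ≤ t → ‖X t‖ ≤ R t := by
    intro t ht
    simp only [hR]
    rw [← hX0]
    refine hrate.norm_le hN (fun s hs => ?_) ht
    have h1 := drift_dot_le hg s (X s)
    have h2 := mul_nonneg hc.le (dot_gradient_pen_clampPlane_nonneg (hR0 s) (X s))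
    simp only [hG, indicator_of_mem (mem_Ioi.2 hs), PiLp.sub_apply, PiLp.smul_apply, smul_eq_mul]
    linarith
  refine ⟨X, IsMildSolution.of_integral_eq hg hXc.continuousOn fun t ht => ?_⟩
  rw [hX t ht]
  congr 1
  refine intervalIntegral.integral_congr_ae (Eventually.of_forall fun s hs => ?_)
  rw [uIoc_of_le ht] at hs
  simp only [hG, indicator_of_mem (mem_Ioi.2 hs.1), velocity, clampPlane_of_norm_le (hb s hs.1.le)]

theorem IsMildSolution.eqOn {N L : ℝ} {g : ℝ → Plane → Plane} (hg : IsDrift N L g) {ε : ℝ}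
    (hε : 0 < ε) {x : Plane} {X Y : ℝ → Plane} (hX : IsMildSolution g ε x X)
    (hY : IsMildSolution g ε x Y) : EqOn X Y (Ici 0) := by
  intro t ht
  have ht : (0 : ℝ) ≤ t := ht
  have hc : 0 < ε⁻¹ := inv_pos.2 hε
  set R := Real.exp t * (‖x‖ + N)
  have hRb : ∀ {Z}, IsMildSolution g ε x Z → ∀ s ∈ Ioo 0 t, ∀ i, |Z s i| ≤ R := by
    intro Z hZ s hs i
    refine (abs_coord_le _ _).trans ((hZ.norm_le hg hε hs.1.le).trans ?_)
    exact mul_le_mul_of_nonneg_right (Real.exp_le_exp.2 hs.2.le)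
      (add_nonneg (norm_nonneg _) hg.nonneg)
  -- Λ is a Lipschitz constant of the field on the region that both solutions occupy up to time t;
  -- Gronwall for |X - Y|² follows.
  set Λ := L + ε⁻¹ * (12 * R ^ 2) with hΛ
  have hrate : HasRate (fun s => velocity g ε X s - velocity g ε Y s) (fun s => X s - Y s) := by
    refine ⟨fun a b ha hb => (hX.rate.integrable a b ha hb).sub (hY.rate.integrable a b ha hb),
      fun s hs => ?_⟩
    rw [intervalIntegral.integral_sub (hX.rate.integrable _ _ le_rfl hs)
      (hY.rate.integrable _ _ le_rfl hs), hX.rate.eq s hs, hY.rate.eq s hs]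
    abel
  set D := fun s => X s - Y s with hD
  set W := fun s => velocity g ε X s - velocity g ε Y s with hW
  have key := hrate.le_of_ae (a := 0) (b := t) le_rfl ht
    (u := fun s => Real.exp (-(2 * Λ * s)) * (D s 0 * D s 0 + D s 1 * D s 1))
    (u' := fun s => Real.exp (-(2 * Λ * s)) * (2 * (D s 0 * W s 0 + D s 1 * W s 1)
      - 2 * Λ * (D s 0 * D s 0 + D s 1 * D s 1)))
    (by
      have e : AbsolutelyContinuousOnInterval (fun s : ℝ => Real.exp (-(2 * Λ * s))) 0 t :=
        ContDiff.absolutelyContinuous (by fun_prop) _ _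
      have p := hrate.absolutelyContinuous le_rfl ht 0
      have q := hrate.absolutelyContinuous le_rfl ht 1
      exact e.mul ((p.mul p).add (q.mul q)))
    (by
      intro s _ hs
      have p := hasDerivAt_coord hs 0
      have q := hasDerivAt_coord hs 1
      have e : HasDerivAt (fun s : ℝ => Real.exp (-(2 * Λ * s)))
          (Real.exp (-(2 * Λ * s)) * (-(2 * Λ * 1))) s :=
        (((hasDerivAt_id s).const_mul (2 * Λ)).neg).exp
      refine (e.mul ((p.mul p).add (q.mul q))).congr_deriv ?_
      simp only [Pi.add_apply, Pi.mul_apply]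
      ring)
    (by
      intro s hs
      apply mul_nonpos_of_nonneg_of_nonpos (Real.exp_pos _).le
      have h1 : ‖W s‖ ≤ Λ * ‖D s‖ := by
        have e : W s = (g s (X s) - g s (Y s)) -
            ε⁻¹ • (gradient pen (X s) - gradient pen (Y s)) := by
          simp only [hW, velocity]
          rw [smul_sub]; abel
        rw [e]
        refine (norm_sub_le _ _).trans ?_
        rw [norm_smul, Real.norm_of_nonneg hc.le]
        have h2 := hg.lip s (X s) (Y s)
        have h3 := mul_le_mul_of_nonneg_left
          (norm_gradient_pen_sub_le (hRb hX s hs) (hRb hY s hs)) hc.le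
        simp only [hΛ, hD]
        linarith
      have h2 := dot_le_norm_mul_norm (D s) (W s)
      have h3 := mul_le_mul_of_nonneg_left h1 (norm_nonneg (D s))
      have h4 : D s 0 * D s 0 + D s 1 * D s 1 = ‖D s‖ * ‖D s‖ := by
        have := norm_sq_plane (D s)
        simp only [sq] at this
        exact this.symm
      rw [h4]
      linarith)
  have h0 : D 0 = 0 := by simp [hD, hX.initial, hY.initial]
  rw [h0] at key
  simp only [PiLp.zero_apply, mul_zero, add_zero] at key
  have h1 : D t 0 * D t 0 + D t 1 * D t 1 ≤ 0 := nonpos_of_mul_nonpos_right key (Real.exp_pos _)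
  have h2 := norm_sq_plane (D t)
  have h3 : ‖D t‖ = 0 := by
    have : ‖D t‖ ^ 2 ≤ 0 := by nlinarith
    exact pow_eq_zero_iff two_ne_zero |>.1 (le_antisymm this (sq_nonneg _))
  exact sub_eq_zero.1 (norm_eq_zero.1 h3)

/-! ### Decay, energy and hyperbolic estimates uniform in ε -/

/-- The derivative of the penalization along a path of velocity `v`. -/
theorem hasDerivAt_pen {X : ℝ → Plane} {v : Plane} {t : ℝ} (h : HasDerivAt X v t) :
    HasDerivAt (fun s => pen (X s))
      (gradient pen (X t) 0 * v 0 + gradient pen (X t) 1 * v 1) t := by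
  have p := hasDerivAt_coord h 0
  have q := hasDerivAt_coord h 1
  refine ((p.pow 2).mul (q.pow 2)).congr_deriv ?_
  simp
  ring

theorem HasRate.absolutelyContinuous_pen {w X : ℝ → Plane} (h : HasRate w X) {a b : ℝ}
    (ha : 0 ≤ a) (hb : 0 ≤ b) : AbsolutelyContinuousOnInterval (fun t => pen (X t)) a b := by
  have p := h.absolutelyContinuous ha hb 0
  have q := h.absolutelyContinuous ha hb 1
  refine ((p.mul p).mul (q.mul q)).congr fun t _ => ?_
  simp only [Pi.mul_apply, pen]
  ring

/-- Since |∇d|² = 4d|y|², this is |y|² ≥ 2|y₁y₂|. It is a Łojasiewicz inequality with exponent 3/4,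
valid on the whole plane even though d degenerates at the origin. -/
theorem eight_mul_le_norm_sq_gradient_pen (y : Plane) :
    8 * |y 0 * y 1| ^ 3 ≤ ‖gradient pen y‖ ^ 2 := by
  rw [norm_sq_gradient_pen, norm_sq_plane]
  have h1 : pen y = |y 0 * y 1| ^ 2 := by rw [sq_abs]; simp [pen]; ring
  have h2 : 2 * |y 0 * y 1| ≤ y 0 ^ 2 + y 1 ^ 2 := by
    rw [abs_mul]
    nlinarith [sq_nonneg (|y 0| - |y 1|), sq_abs (y 0), sq_abs (y 1)]
  rw [h1]
  have := mul_le_mul_of_nonneg_left h2 (sq_nonneg |y 0 * y 1|)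
  nlinarith

/-- Differential inequality for the penalization along a trajectory, with free parameter `lam`. -/
theorem pen_rate_le {F G : Plane} {y : Plane} {N ε lam : ℝ} (hε : 0 < ε) (hlam : 0 < lam)
    (hF : F = gradient pen y) (hG : ‖G‖ ≤ N) :
    6 * lam / ε * (pen y - (ε ^ 2 * N ^ 2 / (12 * lam) + lam ^ 2 / 3)) +
      (F 0 * (G - ε⁻¹ • F) 0 + F 1 * (G - ε⁻¹ • F) 1) ≤ 0 := by
  have h1 := eight_mul_le_norm_sq_gradient_pen y
  rw [← hF] at h1
  have h2 := dot_le_norm_mul_norm F G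
  have h3 : ‖F‖ * ‖G‖ ≤ ‖F‖ * N := mul_le_mul_of_nonneg_left hG (norm_nonneg _)
  have h4 := norm_sq_plane F
  set m := |y 0 * y 1|
  have hm : 0 ≤ m := abs_nonneg _
  have h5 : pen y = m ^ 2 := by simp only [m]; rw [sq_abs]; simp [pen]; ring
  -- This is 2m³ ≥ 3 lam m² - lam³, the tangent bound of the cubic in m² at m = lam. It uses half of
  -- |F|²; the other half absorbs ε|F|N.
  have h6 : 0 ≤ (m - lam) ^ 2 * (2 * m + lam) := by positivity
  have e : 6 * lam / ε * (pen y - (ε ^ 2 * N ^ 2 / (12 * lam) + lam ^ 2 / 3)) +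
      (F 0 * (G - ε⁻¹ • F) 0 + F 1 * (G - ε⁻¹ • F) 1) =
      (6 * lam * pen y - ε ^ 2 * N ^ 2 / 2 - 2 * lam ^ 3 + ε * (F 0 * G 0 + F 1 * G 1)
        - (F 0 ^ 2 + F 1 ^ 2)) / ε := by
    simp only [PiLp.sub_apply, PiLp.smul_apply, smul_eq_mul]
    field_simp
    ring
  rw [e, ← h4, h5]
  apply div_nonpos_of_nonpos_of_nonneg _ hε.le
  have h7 : ε * (F 0 * G 0 + F 1 * G 1) ≤ ε * (‖F‖ * N) :=
    mul_le_mul_of_nonneg_left (h2.trans h3) hε.le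
  nlinarith [sq_nonneg (‖F‖ - ε * N)]

/-- The quantity `x₁² - x₂²`, conserved by the gradient flow. -/
def hyp (y : Plane) : ℝ := y 0 ^ 2 - y 1 ^ 2

theorem abs_dot_conj_le (y z : Plane) : |y 0 * z 0 - y 1 * z 1| ≤ ‖y‖ * ‖z‖ := by
  refine abs_le_of_sq_le_sq ?_ (by positivity)
  rw [mul_pow, norm_sq_plane, norm_sq_plane]
  nlinarith [sq_nonneg (y 0 * z 1 + y 1 * z 0)]

namespace IsMildSolution

variable {N L : ℝ} {g : ℝ → Plane → Plane} {ε : ℝ} {x : Plane} {X : ℝ → Plane}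

theorem pen_le_exp (hg : IsDrift N L g) (hε : 0 < ε) (h : IsMildSolution g ε x X) {lam : ℝ}
    (hlam : 0 < lam) {t : ℝ} (ht : 0 ≤ t) :
    pen (X t) ≤ Real.exp (-(6 * lam / ε * t)) * pen x +
      (ε ^ 2 * N ^ 2 / (12 * lam) + lam ^ 2 / 3) := by
  set B := ε ^ 2 * N ^ 2 / (12 * lam) + lam ^ 2 / 3 with hB
  have hB0 : 0 ≤ B := by positivity
  set a := 6 * lam / ε with ha
  have key := h.rate.le_of_ae (a := 0) (b := t) le_rfl ht
    (u := fun s => Real.exp (a * s) * (pen (X s) - B))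
    (u' := fun s => Real.exp (a * s) * (a * (pen (X s) - B) +
      (gradient pen (X s) 0 * velocity g ε X s 0 + gradient pen (X s) 1 * velocity g ε X s 1)))
    (by
      have e : AbsolutelyContinuousOnInterval (fun s : ℝ => Real.exp (a * s)) 0 t :=
        ContDiff.absolutelyContinuous (by fun_prop) _ _
      have c : AbsolutelyContinuousOnInterval (fun _ : ℝ => B) 0 t :=
        ContDiff.absolutelyContinuous (by fun_prop) _ _
      exact e.mul ((h.rate.absolutelyContinuous_pen le_rfl ht).sub c))
    (by
      intro s _ hs
      have e : HasDerivAt (fun s : ℝ => Real.exp (a * s)) (Real.exp (a * s) * (a * 1)) s :=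
        ((hasDerivAt_id s).const_mul a).exp
      refine (e.mul ((hasDerivAt_pen hs).sub_const B)).congr_deriv ?_
      ring)
    (by
      intro s _
      apply mul_nonpos_of_nonneg_of_nonpos (Real.exp_pos _).le
      exact pen_rate_le hε hlam rfl (hg.norm_le s (X s)))
  simp only [mul_zero, Real.exp_zero, one_mul, h.initial] at key
  have h1 := mul_le_mul_of_nonneg_left key (Real.exp_pos (-(a * t))).le
  rw [← mul_assoc, ← Real.exp_add] at h1
  simp only [neg_add_cancel, Real.exp_zero, one_mul] at h1
  have h2 := mul_nonneg (Real.exp_pos (-(a * t))).le hB0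
  linarith

/-- The exponential is traded for a power by e^(-z) ≤ 4!/z⁴. With `lam` = ε^(2/3) the fourth power
gives ε^(4/3), the same order as the other term. -/
theorem pen_le (hg : IsDrift N L g) (hε : 0 < ε) (h : IsMildSolution g ε x X) {lam : ℝ}
    (hlam : 0 < lam) {t : ℝ} (ht : 0 < t) :
    pen (X t) ≤ 24 * (ε / (6 * lam * t)) ^ 4 * pen x +
      (ε ^ 2 * N ^ 2 / (12 * lam) + lam ^ 2 / 3) := by
  refine (h.pen_le_exp hg hε hlam ht.le).trans ?_
  have hz : 0 < 6 * lam / ε * t := by positivity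
  have h1 := Real.pow_div_factorial_le_exp _ hz.le 4
  have h2 : Real.exp (-(6 * lam / ε * t)) ≤ 24 * (ε / (6 * lam * t)) ^ 4 := by
    rw [Real.exp_neg]
    refine (inv_anti₀ (by positivity) h1).trans (le_of_eq ?_)
    simp only [Nat.factorial]
    push_cast
    field_simp
  have := mul_le_mul_of_nonneg_right h2 (pen_nonneg x)
  linarith

/-- The level `lam` = ε^(2/3) balances ε²/lam against lam², both being ε^(4/3); one factor ε is then
divided out. -/
theorem inv_mul_pen_le (hg : IsDrift N L g) (hε : 0 < ε) (h : IsMildSolution g ε x X) {t : ℝ}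
    (ht : 0 < t) :
    ε⁻¹ * pen (X t) ≤ ε ^ (1 / 3 : ℝ) * (24 / (6 * t) ^ 4 * pen x + N ^ 2 / 12 + 1 / 3) := by
  set η := ε ^ (1 / 3 : ℝ) with hη
  have h0 : 0 < η := Real.rpow_pos_of_pos hε _
  have h3 : η ^ 3 = ε := by
    rw [hη, ← Real.rpow_natCast, ← Real.rpow_mul hε.le]; norm_num
  have h1 := h.pen_le hg hε (pow_pos h0 2) ht
  rw [inv_mul_le_iff₀ hε]
  refine h1.trans (le_of_eq ?_)
  rw [← h3]
  field_simp
  ring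

theorem hasRate_penaltyTerm (h : IsMildSolution g ε x X) :
    HasRate (fun s => ε⁻¹ • gradient pen (X s)) (penaltyTerm ε X) := by
  refine ⟨fun a b ha hb => (intervalIntegrable_gradient_pen h.rate.continuousOn ha hb).smul ε⁻¹,
    fun t _ => ?_⟩
  simp [penaltyTerm, intervalIntegral.integral_smul]

/-- Cauchy–Schwarz applied to the energy inequality, stated for a general path P so that it covers
both X and k. -/
theorem norm_sq_increment_le (h : IsMildSolution g ε x X) {w P : ℝ → Plane} (hP : HasRate w P)
    (hw : ∀ r, ‖w r‖ ^ 2 ≤ N ^ 2 - 2 * (ε⁻¹ * (gradient pen (X r) 0 * velocity g ε X r 0 +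
      gradient pen (X r) 1 * velocity g ε X r 1)))
    {s t : ℝ} (hs : 0 ≤ s) (hst : s ≤ t) :
    ‖P t - P s‖ ^ 2 ≤
      (t - s) ^ 2 * N ^ 2 + 2 * (t - s) * (ε⁻¹ * pen (X s) - ε⁻¹ * pen (X t)) := by
  have ht := hs.trans hst
  set τ := t - s with hτ
  set m := P t - P s with hm
  have hm2 := norm_sq_plane m
  -- Cauchy–Schwarz is done pointwise with the total increment m frozen: 2τ m·w ≤ τ²|w|² + |m|². No
  -- integral of |w|² is formed.
  have key := AbsolutelyContinuousOnInterval.le_of_ae_hasDerivAt_nonpos hst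
    (u := fun r => 2 * τ * (m 0 * P r 0 + m 1 * P r 1) + 2 * τ ^ 2 * ε⁻¹ * pen (X r)
      - (τ ^ 2 * N ^ 2 + ‖m‖ ^ 2) * r)
    (u' := fun r => 2 * τ * (m 0 * w r 0 + m 1 * w r 1) + 2 * τ ^ 2 * ε⁻¹ *
      (gradient pen (X r) 0 * velocity g ε X r 0 + gradient pen (X r) 1 * velocity g ε X r 1)
      - (τ ^ 2 * N ^ 2 + ‖m‖ ^ 2) * 1)
    (by
      have p := (hP.absolutelyContinuous hs ht 0).const_mul (m 0)
      have q := (hP.absolutelyContinuous hs ht 1).const_mul (m 1)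
      have d := (h.rate.absolutelyContinuous_pen hs ht).const_mul (2 * τ ^ 2 * ε⁻¹)
      have c : AbsolutelyContinuousOnInterval (fun r : ℝ => (τ ^ 2 * N ^ 2 + ‖m‖ ^ 2) * r) s t :=
        ContDiff.absolutelyContinuous (by fun_prop) _ _
      exact (((p.add q).const_mul (2 * τ)).add d).sub c)
    (by
      filter_upwards [h.rate.ae_hasDerivAt, hP.ae_hasDerivAt] with r h1 h2 hr
      have hr0 : 0 < r := lt_of_le_of_lt hs hr.1
      have p := (hasDerivAt_coord (h2 hr0) 0).const_mul (m 0)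
      have q := (hasDerivAt_coord (h2 hr0) 1).const_mul (m 1)
      have d := (hasDerivAt_pen (h1 hr0)).const_mul (2 * τ ^ 2 * ε⁻¹)
      have c := (hasDerivAt_id r).const_mul (τ ^ 2 * N ^ 2 + ‖m‖ ^ 2)
      refine ⟨(((p.add q).const_mul (2 * τ)).add d).sub c, ?_⟩
      have h3 := mul_le_mul_of_nonneg_left (hw r) (sq_nonneg τ)
      have h4 := norm_sq_plane (w r)
      nlinarith [sq_nonneg (τ * w r 0 - m 0), sq_nonneg (τ * w r 1 - m 1)])
  simp only at key
  have e0 : m 0 = P t 0 - P s 0 := rfl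
  have e1 : m 1 = P t 1 - P s 1 := rfl
  have h5 : 2 * τ * ‖m‖ ^ 2 + 2 * τ ^ 2 * ε⁻¹ * (pen (X t) - pen (X s)) ≤
      (τ ^ 2 * N ^ 2 + ‖m‖ ^ 2) * τ := by
    have e2 : ‖m‖ ^ 2 = m 0 * (P t 0 - P s 0) + m 1 * (P t 1 - P s 1) := by
      rw [hm2, ← e0, ← e1]; ring
    have e3 : 2 * τ * ‖m‖ ^ 2 =
        2 * τ * (m 0 * (P t 0 - P s 0) + m 1 * (P t 1 - P s 1)) := by rw [e2]
    rw [e3]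
    have e4 : (τ ^ 2 * N ^ 2 + ‖m‖ ^ 2) * τ =
      (τ ^ 2 * N ^ 2 + ‖m‖ ^ 2) * t - (τ ^ 2 * N ^ 2 + ‖m‖ ^ 2) * s := by rw [hτ]; ring
    rw [e4]
    linarith
  rcases hst.eq_or_lt with hst | hst
  · have : m = 0 := by rw [hm, hst, sub_self]
    simp [this, hτ, hst]
  · have hτ0 : 0 < τ := sub_pos.2 hst
    have h6 : τ * ‖m‖ ^ 2 ≤
        τ * (τ ^ 2 * N ^ 2 + 2 * τ * (ε⁻¹ * pen (X s) - ε⁻¹ * pen (X t))) := by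
      linarith
    exact le_of_mul_le_mul_left h6 hτ0

/-- The energy identity |Ẋ|² + 2p·Ẋ = |f|² - |p|², with p the penalty force. -/
theorem norm_sq_sub_le (hg : IsDrift N L g) (h : IsMildSolution g ε x X)
    {s t : ℝ} (hs : 0 ≤ s) (hst : s ≤ t) :
    ‖X t - X s‖ ^ 2 ≤
      (t - s) ^ 2 * N ^ 2 + 2 * (t - s) * (ε⁻¹ * pen (X s) - ε⁻¹ * pen (X t)) := by
  refine h.norm_sq_increment_le h.rate (fun r => ?_) hs hst
  have h1 := norm_sq_plane (velocity g ε X r)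
  have h2 := norm_sq_plane (g r (X r))
  have h3 := pow_le_pow_left₀ (norm_nonneg _) (hg.norm_le r (X r)) 2
  simp only [velocity, PiLp.sub_apply, PiLp.smul_apply, smul_eq_mul] at h1 ⊢
  nlinarith [sq_nonneg (ε⁻¹ * gradient pen (X r) 0), sq_nonneg (ε⁻¹ * gradient pen (X r) 1)]

/-- Here k̇ = p and |p|² + 2p·(f - p) = |f|² - |f - p|². -/
theorem norm_sq_penaltyTerm_sub_le (hg : IsDrift N L g) (h : IsMildSolution g ε x X)
    {s t : ℝ} (hs : 0 ≤ s) (hst : s ≤ t) :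
    ‖penaltyTerm ε X t - penaltyTerm ε X s‖ ^ 2 ≤
      (t - s) ^ 2 * N ^ 2 + 2 * (t - s) * (ε⁻¹ * pen (X s) - ε⁻¹ * pen (X t)) := by
  refine h.norm_sq_increment_le h.hasRate_penaltyTerm (fun r => ?_) hs hst
  have h1 := norm_sq_plane (ε⁻¹ • gradient pen (X r))
  have h2 := norm_sq_plane (g r (X r))
  have h3 := pow_le_pow_left₀ (norm_nonneg _) (hg.norm_le r (X r)) 2
  simp only [velocity, PiLp.sub_apply, PiLp.smul_apply, smul_eq_mul] at h1 ⊢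
  nlinarith [sq_nonneg (g r (X r) 0 - ε⁻¹ * gradient pen (X r) 0),
    sq_nonneg (g r (X r) 1 - ε⁻¹ * gradient pen (X r) 1)]

/-- The right-hand side of the energy estimate bounds a square, hence is nonnegative; a bound on the
energy at one time therefore propagates forward. -/
theorem inv_mul_pen_le_add (hg : IsDrift N L g) (h : IsMildSolution g ε x X)
    {s t : ℝ} (hs : 0 ≤ s) (hst : s ≤ t) :
    ε⁻¹ * pen (X t) ≤ ε⁻¹ * pen (X s) + (t - s) * N ^ 2 := by
  rcases hst.eq_or_lt with rfl | hlt
  · simp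
  · have h1 := (sq_nonneg _).trans (h.norm_sq_sub_le hg hs hst)
    have hτ : 0 < t - s := sub_pos.2 hlt
    have h2 : 0 ≤ (t - s) *
        ((t - s) * N ^ 2 + 2 * (ε⁻¹ * pen (X s) - ε⁻¹ * pen (X t))) := by nlinarith
    have h3 := nonneg_of_mul_nonneg_right h2 hτ
    have h4 : 0 ≤ (t - s) * N ^ 2 := by positivity
    linarith

theorem abs_hyp_sub_le (hg : IsDrift N L g) (hε : 0 < ε) (h : IsMildSolution g ε x X) {t : ℝ}
    (ht : 0 ≤ t) : |hyp (X t) - hyp x| ≤ 2 * N * (Real.exp t * (‖x‖ + N)) * t := by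
  have hN := hg.nonneg
  set C := 2 * N * (Real.exp t * (‖x‖ + N)) with hC
  have main : ∀ σ : ℝ, |σ| = 1 → σ * (hyp (X t) - hyp x) ≤ C * t := by
    intro σ hσ
    have key := h.rate.le_of_ae (a := 0) (b := t) le_rfl ht
      (u := fun s => σ * (X s 0 * X s 0 - X s 1 * X s 1) - C * s)
      (u' := fun s => σ * (2 * (X s 0 * velocity g ε X s 0 - X s 1 * velocity g ε X s 1)) - C * 1)
      (by
        have p := h.rate.absolutelyContinuous le_rfl ht 0
        have q := h.rate.absolutelyContinuous le_rfl ht 1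
        have c : AbsolutelyContinuousOnInterval (fun r : ℝ => C * r) 0 t :=
          ContDiff.absolutelyContinuous (by fun_prop) _ _
        exact (((p.mul p).sub (q.mul q)).const_mul σ).sub c)
      (by
        intro s _ hs
        have p := hasDerivAt_coord hs 0
        have q := hasDerivAt_coord hs 1
        refine ((((p.mul p).sub (q.mul q)).const_mul σ).sub
          ((hasDerivAt_id s).const_mul C)).congr_deriv ?_
        ring)
      (by
        intro s hs
        -- The penalty drops out: ∇d is orthogonal to the gradient of x₁² - x₂². Hence the bound is
        -- free of ε.
        have e : X s 0 * velocity g ε X s 0 - X s 1 * velocity g ε X s 1 =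
            X s 0 * g s (X s) 0 - X s 1 * g s (X s) 1 := by
          simp [velocity]; ring
        rw [e]
        have h1 := abs_dot_conj_le (X s) (g s (X s))
        have h2 : ‖X s‖ ≤ Real.exp t * (‖x‖ + N) := (h.norm_le hg hε hs.1.le).trans
          (mul_le_mul_of_nonneg_right (Real.exp_le_exp.2 hs.2.le) (by positivity))
        have h3 := mul_le_mul h2 (hg.norm_le s (X s)) (norm_nonneg _) (by positivity)
        have h4 : σ * (X s 0 * g s (X s) 0 - X s 1 * g s (X s) 1) ≤
            |X s 0 * g s (X s) 0 - X s 1 * g s (X s) 1| := by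
          refine (le_abs_self _).trans ?_
          rw [abs_mul, hσ, one_mul]
        simp only [hC]
        linarith)
    simp only [h.initial, mul_zero, sub_zero] at key
    simp only [hyp]
    linarith
  have h1 := main 1 (by simp)
  have h2 := main (-1) (by simp)
  exact abs_le.2 ⟨by linarith, by linarith⟩

end IsMildSolution

/-! ### Locating the point reached through the initial layer -/

/-- The limit of the gradient flow starting at `x`. -/
def flowLimit (x : Plane) : Plane :=
  !₂[SignType.sign (x 0) * √(max (hyp x) 0), SignType.sign (x 1) * √(max (-hyp x) 0)]

theorem flowLimit_mem_network (x : Plane) : flowLimit x ∈ network := by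
  rw [mem_network_iff]
  rcases le_total (hyp x) 0 with h | h
  · simp [pen, flowLimit, h]
  · simp [pen, flowLimit, h]

/-- When h > 0, multiplying by the sign of a reduces to w ≥ 0, where (w - r)² ≤ |w - r|(w + r) = |w²
- r²| with r = √h. -/
theorem sq_sub_sign_mul_sqrt_le {a w h : ℝ} (ha : 0 < h → a ≠ 0 ∧ 0 ≤ w * a) :
    (w - SignType.sign a * √(max h 0)) ^ 2 ≤ |w ^ 2 - max h 0| := by
  rcases le_or_gt h 0 with hh | hh
  · simp [hh]
  · obtain ⟨ha0, haw⟩ := ha hh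
    have h1 : (SignType.sign a : ℝ) ^ 2 = 1 := by
      rcases lt_or_gt_of_ne ha0 with h | h <;> simp [h]
    rw [max_eq_left hh.le]
    set r := √h
    have hr : r ^ 2 = h := Real.sq_sqrt hh.le
    have hr0 : 0 ≤ r := Real.sqrt_nonneg h
    have h2 : 0 ≤ SignType.sign a * w := by
      rcases lt_or_gt_of_ne ha0 with h | h
      · simp [h]; nlinarith
      · simp [h]; nlinarith
    have h3 : (w - SignType.sign a * r) ^ 2 = (SignType.sign a * w - r) ^ 2 := by
      have : (SignType.sign a * w - r) ^ 2 = (SignType.sign a : ℝ) ^ 2 * w ^ 2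
        - 2 * (SignType.sign a * w * r) + r ^ 2 := by ring
      rw [this, h1]
      have : (w - SignType.sign a * r) ^ 2 = w ^ 2 - 2 * (SignType.sign a * w * r)
        + (SignType.sign a : ℝ) ^ 2 * r ^ 2 := by ring
      rw [this, h1]; ring
    have h4 : w ^ 2 - h = (SignType.sign a * w - r) * (SignType.sign a * w + r) := by
      have : (SignType.sign a * w - r) * (SignType.sign a * w + r) =
        (SignType.sign a : ℝ) ^ 2 * w ^ 2 - r ^ 2 := by ring
      rw [this, h1, hr]; ring
    rw [h3, h4, abs_mul, ← sq_abs, sq]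
    refine mul_le_mul_of_nonneg_left ?_ (abs_nonneg _)
    rw [abs_of_nonneg (add_nonneg h2 hr0)]
    exact abs_le.2 ⟨by linarith, by linarith⟩

/-- The smaller of |w₁|², |w₂|² is at most |w₁w₂| = √d(w), so near Γ the value of x₁² - x₂² nearly
fixes both squares. A sign is needed only for the coordinate that survives in the limit. -/
theorem norm_sq_sub_flowLimit_le {x w : Plane} (h0 : 0 < hyp x → 0 ≤ w 0 * x 0)
    (h1 : hyp x < 0 → 0 ≤ w 1 * x 1) :
    ‖w - flowLimit x‖ ^ 2 ≤ 4 * (|hyp w - hyp x| + √(pen w)) := by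
  have a0 := sq_sub_sign_mul_sqrt_le (a := x 0) (w := w 0) (h := hyp x) fun h =>
    ⟨fun h' => by simp [hyp, h'] at h; nlinarith [sq_nonneg (x 1)], h0 h⟩
  have a1 := sq_sub_sign_mul_sqrt_le (a := x 1) (w := w 1) (h := -hyp x) fun h =>
    ⟨fun h' => by simp [hyp, h'] at h; nlinarith [sq_nonneg (x 0)], h1 (neg_pos.1 h)⟩
  rw [norm_sq_plane]
  have e0 : (w - flowLimit x) 0 = w 0 - SignType.sign (x 0) * √(max (hyp x) 0) := rfl
  have e1 : (w - flowLimit x) 1 = w 1 - SignType.sign (x 1) * √(max (-hyp x) 0) := rfl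
  rw [e0, e1]
  have hm : √(pen w) = |w 0| * |w 1| := by
    rw [← abs_mul, ← Real.sqrt_sq_eq_abs]; congr 1; simp [pen]; ring
  rw [hm]
  refine (add_le_add a0 a1).trans ?_
  set h := hyp x
  have hw : hyp w = |w 0| ^ 2 - |w 1| ^ 2 := by simp [hyp]
  rw [hw, ← sq_abs (w 0), ← sq_abs (w 1)]
  have p0 := abs_nonneg (w 0)
  have q0 := abs_nonneg (w 1)
  generalize |w 0| = p at *
  generalize |w 1| = q at *
  have hΔ1 := le_abs_self (p ^ 2 - q ^ 2 - h)
  have hΔ2 := neg_abs_le (p ^ 2 - q ^ 2 - h)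
  have hpq : 0 ≤ p * q := mul_nonneg p0 q0
  have b0 : |p ^ 2 - max h 0| ≤ 2 * (|p ^ 2 - q ^ 2 - h| + p * q) := by
    rcases le_total p q with hle | hle <;> rcases le_total h 0 with hh | hh
    · rw [max_eq_right hh]; exact abs_le.2 ⟨by nlinarith, by nlinarith⟩
    · rw [max_eq_left hh]; exact abs_le.2 ⟨by nlinarith, by nlinarith⟩
    · rw [max_eq_right hh]; exact abs_le.2 ⟨by nlinarith, by nlinarith⟩
    · rw [max_eq_left hh]; exact abs_le.2 ⟨by nlinarith, by nlinarith⟩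
  have b1 : |q ^ 2 - max (-h) 0| ≤ 2 * (|p ^ 2 - q ^ 2 - h| + p * q) := by
    rcases le_total p q with hle | hle <;> rcases le_total h 0 with hh | hh
    · rw [max_eq_left (by linarith)]; exact abs_le.2 ⟨by nlinarith, by nlinarith⟩
    · rw [max_eq_right (by linarith)]; exact abs_le.2 ⟨by nlinarith, by nlinarith⟩
    · rw [max_eq_left (by linarith)]; exact abs_le.2 ⟨by nlinarith, by nlinarith⟩
    · rw [max_eq_right (by linarith)]; exact abs_le.2 ⟨by nlinarith, by nlinarith⟩
  linarith

/-- A continuous path on which a coordinate does not vanish keeps the sign of that coordinate. -/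
theorem mul_coord_nonneg_of_ne_zero {X : ℝ → Plane} (hX : ContinuousOn X (Ici 0)) {t : ℝ}
    (ht : 0 ≤ t) (i : Fin 2) (h : ∀ r ∈ Icc 0 t, X r i ≠ 0) : 0 ≤ X t i * X 0 i := by
  by_contra! hneg
  have hc : ContinuousOn (fun r => X r i * X 0 i) (Icc 0 t) :=
    ((continuous_coord i).comp_continuousOn (hX.mono fun _ hr => hr.1)).mul continuousOn_const
  obtain ⟨r, hr, h0⟩ := intermediate_value_Icc' ht hc ⟨hneg.le, mul_self_nonneg (X 0 i)⟩
  rcases mul_eq_zero.1 h0 with h1 | h1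
  · exact h r hr h1
  · exact h 0 ⟨le_rfl, ht⟩ h1

/-- The smallness condition keeps x₁² - x₂² away from zero up to time t, so the dominant coordinate
cannot vanish and keeps its sign. If the initial value is zero, the target is the origin and signs
are irrelevant. -/
theorem IsMildSolution.norm_sq_sub_flowLimit_le {N L : ℝ} {g : ℝ → Plane → Plane} {ε : ℝ}
    {x : Plane} {X : ℝ → Plane} (hg : IsDrift N L g) (hε : 0 < ε) (h : IsMildSolution g ε x X)
    {t : ℝ} (ht : 0 ≤ t)
    (hsmall : 2 * N * (Real.exp t * (‖x‖ + N)) * t < |hyp x| ∨ hyp x = 0) :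
    ‖X t - flowLimit x‖ ^ 2 ≤
      4 * (2 * N * (Real.exp t * (‖x‖ + N)) * t + √(pen (X t))) := by
  have hN := hg.nonneg
  have hr : hyp x ≠ 0 → ∀ r ∈ Icc 0 t, |hyp (X r) - hyp x| < |hyp x| := by
    intro h0 r hr
    refine (h.abs_hyp_sub_le hg hε hr.1).trans_lt (lt_of_le_of_lt ?_ (hsmall.resolve_right h0))
    have h1 : Real.exp r ≤ Real.exp t := Real.exp_le_exp.2 hr.2
    have h2 := hr.1
    have h3 := hr.2
    gcongr
  have h2 := _root_.norm_sq_sub_flowLimit_le (x := x) (w := X t)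
    (by
      intro hp
      rw [← h.initial]
      refine mul_coord_nonneg_of_ne_zero h.rate.continuousOn ht 0 fun r hr' h0 => ?_
      have h1 := hr hp.ne' r hr'
      rw [abs_of_pos hp, abs_lt] at h1
      have : hyp (X r) ≤ 0 := by simp [hyp, h0]; positivity
      linarith [h1.1])
    (by
      intro hp
      rw [← h.initial]
      refine mul_coord_nonneg_of_ne_zero h.rate.continuousOn ht 1 fun r hr' h0 => ?_
      have h1 := hr hp.ne r hr'
      rw [abs_of_neg hp, abs_lt] at h1
      have : 0 ≤ hyp (X r) := by simp [hyp, h0]; positivity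
      linarith [h1.2])
  linarith [h.abs_hyp_sub_le hg hε ht]

/-! ### Weak derivatives and integral equations -/

theorem exists_Icc_of_isCompact {K : Set ℝ} (hK : IsCompact K) (hK0 : K ⊆ Ioi 0) :
    ∃ a b : ℝ, 0 < a ∧ a < b ∧ K ⊆ Ioo a b := by
  rcases K.eq_empty_or_nonempty with rfl | hne
  · exact ⟨1, 2, one_pos, one_lt_two, empty_subset _⟩
  · obtain ⟨m, hm, hmin⟩ := hK.exists_isLeast hne
    obtain ⟨n, hn, hmax⟩ := hK.exists_isGreatest hne
    have h0 : 0 < m := hK0 hm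
    have h1 : m ≤ n := hmin hn
    exact ⟨m / 2, n + 1, by positivity, by linarith,
      fun t ht => ⟨by linarith [hmin ht], by linarith [hmax ht]⟩⟩

theorem plane_integral_coord {a b : ℝ} {F : ℝ → Plane} (hF : IntervalIntegrable F volume a b)
    (i : Fin 2) : (∫ t in a..b, F t) i = ∫ t in a..b, F t i :=
  ((EuclideanSpace.proj (𝕜 := ℝ) i).intervalIntegral_comp_comm hF).symm

theorem HasWeakDerivOn.of_absolutelyContinuous {w X : ℝ → Plane}
    (hX : ∀ a b, 0 < a → 0 < b → ∀ i, AbsolutelyContinuousOnInterval (fun t => X t i) a b)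
    (hd : ∀ᵐ t, 0 < t → HasDerivAt X (w t) t) (hXc : ContinuousOn X (Ioi 0))
    (hw : LocallyIntegrableOn w (Ioi 0)) : HasWeakDerivOn (Ioi 0) X w := by
  refine ⟨hXc.locallyIntegrableOn measurableSet_Ioi, hw, fun φ hφ hcs hsupp => ?_⟩
  obtain ⟨a, b, ha, hab, hK⟩ := exists_Icc_of_isCompact hcs hsupp
  have hb := ha.trans hab
  have hIcc : uIcc a b ⊆ Ioi 0 := by
    rw [uIcc_of_le hab.le]; exact fun t ht => ha.trans_le ht.1
  have hIoc : Ioo a b ⊆ Ioc a b := Ioo_subset_Ioc_self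
  have hφc : Continuous (deriv φ) := hφ.continuous_deriv (by simp)
  rw [← intervalIntegral.integral_eq_integral_of_support_subset (a := a) (b := b),
    ← intervalIntegral.integral_eq_integral_of_support_subset (a := a) (b := b)]
  rotate_left
  · exact (Function.support_smul_subset_left _ _).trans
      ((subset_tsupport φ).trans (hK.trans hIoc))
  · exact (Function.support_smul_subset_left _ _).trans
      (support_deriv_subset.trans (hK.trans hIoc))
  have i1 : IntervalIntegrable (fun t => deriv φ t • X t) volume a b :=
    (hφc.continuousOn.smul (hXc.mono hIcc)).intervalIntegrable
  have hwi : IntervalIntegrable w volume a b := by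
    rw [intervalIntegrable_iff' (by simp)]
    exact hw.integrableOn_compact_subset hIcc isCompact_uIcc
  have i2 : IntervalIntegrable (fun t => φ t • w t) volume a b :=
    hwi.continuousOn_smul hφ.continuous.continuousOn
  have hφa : φ a = 0 := image_eq_zero_of_notMem_tsupport fun h => (hK h).1.false
  have hφb : φ b = 0 := image_eq_zero_of_notMem_tsupport fun h => (hK h).2.false
  ext i
  have hφ1 : AbsolutelyContinuousOnInterval φ a b :=
    ContDiff.absolutelyContinuous (hφ.of_le (by simp)) a b
  have key := hφ1.integral_mul_deriv_eq_deriv_mul (hX a b ha hb i)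
  have e : ∫ t in a..b, φ t * deriv (fun t => X t i) t = ∫ t in a..b, φ t * w t i := by
    refine intervalIntegral.integral_congr_ae ?_
    filter_upwards [hd] with t ht hm
    rw [uIoc_of_le hab.le] at hm
    rw [(hasDerivAt_coord (ht (ha.trans hm.1)) i).deriv]
  rw [plane_integral_coord i1 i, PiLp.neg_apply, plane_integral_coord i2 i]
  simp only [PiLp.smul_apply, smul_eq_mul]
  rw [e, hφa, hφb] at key
  linarith

theorem HasRate.locallyIntegrableOn {w X : ℝ → Plane} (h : HasRate w X) :
    LocallyIntegrableOn w (Ioi 0) := by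
  rw [locallyIntegrableOn_iff (isOpen_Ioi.isLocallyClosed)]
  intro K hK hKc
  obtain ⟨a, b, ha, hab, hKab⟩ := exists_Icc_of_isCompact hKc hK
  have := h.integrable a b ha.le (ha.trans hab).le
  rw [intervalIntegrable_iff, uIoc_of_le hab.le] at this
  exact this.mono_set (hKab.trans Ioo_subset_Ioc_self)

theorem HasRate.hasWeakDerivOn {w X : ℝ → Plane} (h : HasRate w X) :
    HasWeakDerivOn (Ioi 0) X w :=
  .of_absolutelyContinuous (fun _ _ ha hb i => h.absolutelyContinuous ha.le hb.le i)
    h.ae_hasDerivAt (h.continuousOn.mono Ioi_subset_Ici_self) h.locallyIntegrableOn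

theorem integrable_smul_of_continuousOn {ψ : ℝ → ℝ} {u : ℝ → Plane}
    (hu : ContinuousOn u (Ioi 0)) (hψ : Continuous ψ) (hcs : HasCompactSupport ψ)
    (hs : tsupport ψ ⊆ Ioi 0) : Integrable (fun t => ψ t • u t) := by
  refine (integrableOn_iff_integrable_of_support_subset (s := tsupport ψ) ?_).1 ?_
  · exact (Function.support_smul_subset_left _ _).trans (subset_tsupport ψ)
  · exact (hψ.continuousOn.smul (hu.mono hs)).integrableOn_compact hcs

/-- The lemma of du Bois-Reymond on the half-line. -/
theorem exists_const_of_integral_deriv_smul_eq_zero {u : ℝ → Plane} (hu : ContinuousOn u (Ioi 0))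
    (h : ∀ φ : ℝ → ℝ, ContDiff ℝ ∞ φ → HasCompactSupport φ → tsupport φ ⊆ Ioi 0 →
      ∫ t, deriv φ t • u t = 0) : ∃ c, ∀ t, 0 < t → u t = c := by
  obtain ⟨ψ₀, hψ₀, hcs₀, hs₀, hi₀⟩ : ∃ ψ₀ : ℝ → ℝ, ContDiff ℝ ∞ ψ₀ ∧ HasCompactSupport ψ₀ ∧
      tsupport ψ₀ ⊆ Ioi 0 ∧ ∫ t, ψ₀ t = 1 := by
    let B : ContDiffBump (1 : ℝ) := ⟨1 / 4, 1 / 2, by norm_num, by norm_num⟩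
    refine ⟨B.normed volume, B.contDiff_normed, B.hasCompactSupport_normed, ?_, B.integral_normed⟩
    rw [B.tsupport_normed_eq]
    intro t ht
    rw [Metric.mem_closedBall, Real.dist_eq, abs_le] at ht
    change (0 : ℝ) < t
    have : B.rOut = 1 / 2 := rfl
    rw [this] at ht
    linarith [ht.1]
  set c := ∫ t, ψ₀ t • u t with hc
  have main : ∀ ψ : ℝ → ℝ, ContDiff ℝ ∞ ψ → HasCompactSupport ψ → tsupport ψ ⊆ Ioi 0 →
      ∫ t, ψ t • (u t - c) = 0 := by
    intro ψ hψ hcs hs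
    set I := ∫ t, ψ t with hI
    -- Subtracting a multiple of ψ₀ makes the mean zero, so the primitive of θ has compact support
    -- in (0,∞) and is an admissible test function.
    set θ : ℝ → ℝ := fun t => ψ t - I * ψ₀ t with hθ
    have hθs : ContDiff ℝ ∞ θ := hψ.sub (contDiff_const.mul hψ₀)
    have hψi : Integrable ψ := hψ.continuous.integrable_of_hasCompactSupport hcs
    have hψ₀i : Integrable ψ₀ := hψ₀.continuous.integrable_of_hasCompactSupport hcs₀
    have hθi : ∫ t, θ t = 0 := by
      simp only [hθ]
      rw [integral_sub hψi (hψ₀i.const_mul I), integral_const_mul, hi₀]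
      simp [hI]
    obtain ⟨a, b, ha, hab, hK⟩ := exists_Icc_of_isCompact (hcs.union hcs₀) (union_subset hs hs₀)
    have hθ0 : ∀ t, t ∉ Ioo a b → θ t = 0 := by
      intro t ht
      have h1 : ψ t = 0 := image_eq_zero_of_notMem_tsupport fun h => ht (hK (Or.inl h))
      have h2 : ψ₀ t = 0 := image_eq_zero_of_notMem_tsupport fun h => ht (hK (Or.inr h))
      simp [hθ, h1, h2]
    set φ : ℝ → ℝ := fun t => ∫ s in a..t, θ s with hφ
    have hφd : ∀ t, HasDerivAt φ (θ t) t := fun t =>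
      intervalIntegral.integral_hasDerivAt_right (hθs.continuous.intervalIntegrable _ _)
        (hθs.continuous.stronglyMeasurableAtFilter _ _) hθs.continuous.continuousAt
    have hdφ : deriv φ = θ := funext fun t => (hφd t).deriv
    have hφs : ContDiff ℝ ∞ φ :=
      contDiff_infty_iff_deriv.2 ⟨fun t => (hφd t).differentiableAt, by rwa [hdφ]⟩
    have hφ0 : ∀ t, t ∉ Icc a b → φ t = 0 := by
      intro t ht
      rcases lt_or_ge t a with h1 | h1
      · have : ∫ s in a..t, θ s = ∫ s in a..t, (0 : ℝ) := by
          refine intervalIntegral.integral_congr fun s hs => hθ0 s fun hm => ?_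
          rw [uIcc_of_ge h1.le] at hs
          exact absurd hm.1 (not_lt.2 hs.2)
        simp only [hφ, this, intervalIntegral.integral_zero]
      · have h2 : b < t := by
          by_contra! h2
          exact ht ⟨h1, h2⟩
        simp only [hφ]
        rw [intervalIntegral.integral_eq_integral_of_support_subset, hθi]
        intro s hs
        by_contra hm
        exact hs (hθ0 s fun h' => hm ⟨h'.1, h'.2.le.trans h2.le⟩)
    have hts : tsupport φ ⊆ Icc a b := by
      refine closure_minimal (fun t ht => ?_) isClosed_Icc
      by_contra hm
      exact ht (hφ0 t hm)
    have key := h φ hφs (HasCompactSupport.intro isCompact_Icc hφ0)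
      (hts.trans fun t ht => ha.trans_le ht.1)
    rw [hdφ] at key
    have i1 := integrable_smul_of_continuousOn hu hψ.continuous hcs hs
    have i2 := integrable_smul_of_continuousOn hu hψ₀.continuous hcs₀ hs₀
    have e1 : (fun t => θ t • u t) = fun t => ψ t • u t - I • (ψ₀ t • u t) := by
      ext1 t; simp only [hθ, sub_smul, mul_smul]
    have i3 : Integrable (fun t => I • (ψ₀ t • u t)) := i2.smul I
    rw [e1, integral_sub i1 i3, integral_smul] at key
    have e2 : (fun t => ψ t • (u t - c)) = fun t => ψ t • u t - ψ t • c := by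
      ext1 t; rw [smul_sub]
    rw [e2, integral_sub i1 (hψi.smul_const c), integral_smul_const]
    exact key
  have hc' : ContinuousOn (fun t => u t - c) (Ioi 0) := hu.sub continuousOn_const
  have hae := isOpen_Ioi.ae_eq_zero_of_integral_contDiff_smul_eq_zero
    (hc'.locallyIntegrableOn measurableSet_Ioi) main
  have heq : EqOn (fun t => u t - c) (fun _ => 0) (Ioi 0) := by
    refine Measure.eqOn_open_of_ae_eq (μ := volume) ?_ isOpen_Ioi hc' continuousOn_const
    exact (ae_restrict_iff' measurableSet_Ioi).2 hae
  exact ⟨c, fun t ht => sub_eq_zero.1 (heq ht)⟩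

theorem hasRate_primitive {w : ℝ → Plane}
    (hw : ∀ a b : ℝ, 0 ≤ a → 0 ≤ b → IntervalIntegrable w volume a b) :
    HasRate w fun t => ∫ s in (0 : ℝ)..t, w s :=
  ⟨hw, fun t _ => by simp⟩

/-- X minus the primitive of w has zero weak derivative, so it is constant on (0,∞); continuity at 0
identifies the constant as X(0). -/
theorem HasWeakDerivOn.hasRate {w X : ℝ → Plane} (h : HasWeakDerivOn (Ioi 0) X w)
    (hX : ContinuousOn X (Ici 0))
    (hw : ∀ a b : ℝ, 0 ≤ a → 0 ≤ b → IntervalIntegrable w volume a b) : HasRate w X := by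
  have hG := hasRate_primitive hw
  set G : ℝ → Plane := fun t => ∫ s in (0 : ℝ)..t, w s with hGdef
  have hGc := hG.continuousOn
  obtain ⟨c, hc⟩ := exists_const_of_integral_deriv_smul_eq_zero (u := fun t => X t - G t)
    ((hX.sub hGc).mono Ioi_subset_Ici_self)
    (by
      intro φ hφ hcs hs
      have hcs' : HasCompactSupport (deriv φ) := hcs.deriv
      have hs' : tsupport (deriv φ) ⊆ Ioi 0 :=
        (closure_minimal support_deriv_subset (isClosed_tsupport φ)).trans hs
      have hφc : Continuous (deriv φ) := hφ.continuous_deriv (by simp)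
      simp only [smul_sub]
      rw [integral_sub
        (integrable_smul_of_continuousOn (hX.mono Ioi_subset_Ici_self) hφc hcs' hs')
        (integrable_smul_of_continuousOn (hGc.mono Ioi_subset_Ici_self) hφc hcs' hs'),
        h.integral_eq φ hφ hcs hs, hG.hasWeakDerivOn.integral_eq φ hφ hcs hs, sub_self])
  have h0 : X 0 = c := by
    have h1 : Tendsto (fun t => X t - G t) (𝓝[>] 0) (𝓝 (X 0 - G 0)) :=
      ((hX.sub hGc) 0 self_mem_Ici).mono_left (nhdsWithin_mono _ Ioi_subset_Ici_self)
    have h2 : Tendsto (fun t => X t - G t) (𝓝[>] 0) (𝓝 c) := by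
      refine tendsto_const_nhds.congr' ?_
      filter_upwards [self_mem_nhdsWithin] with t ht
      exact (hc t ht).symm
    have h3 := tendsto_nhds_unique h1 h2
    simpa [hGdef] using h3
  refine ⟨hw, fun t ht => ?_⟩
  rcases ht.eq_or_lt with rfl | ht
  · simp
  · rw [h0, ← hc t ht]
    simp [hGdef]

theorem memLp_top_Icc_of_norm_le {u : ℝ → Plane} {a b C : ℝ}
    (hu : AEStronglyMeasurable u (volume.restrict (Ioi 0))) (hab : Icc a b ⊆ Ici 0)
    (hC : ∀ t ∈ Icc a b, 0 < t → ‖u t‖ ≤ C) (p : ℝ≥0∞) :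
    MemLp u p (volume.restrict (Icc a b)) := by
  have hm : AEStronglyMeasurable u (volume.restrict (Icc a b)) := by
    rw [restrict_Ioi_eq_restrict_Ici] at hu
    exact hu.mono_set hab
  refine MemLp.of_bound hm C ?_
  have h0 : ∀ᵐ t : ℝ, t ≠ 0 := by simp [ae_iff, measure_singleton]
  filter_upwards [ae_restrict_of_ae h0, ae_restrict_mem measurableSet_Icc] with t h1 h2
  exact hC t h2 (lt_of_le_of_ne (hab h2) h1.symm)

theorem MemSobolevLoc.restrict_Ioi {p : ℝ≥0∞} {u : ℝ → Plane} (h : MemSobolevLoc p (Ici 0) u) :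
    MemSobolevLoc p (Ioi 0) u := by
  obtain ⟨g, hg, hp⟩ := h
  refine ⟨g, ?_, fun a b hab => hp a b (hab.trans Ioi_subset_Ici_self)⟩
  rwa [interior_Ici, ← isOpen_Ioi.interior_eq] at hg

theorem LipschitzOnWith.hasWeakDerivOn {C : NNReal} {u : ℝ → Plane}
    (hu : LipschitzOnWith C u (Ioi 0)) :
    HasWeakDerivOn (Ioi 0) u (deriv u) ∧ (∀ᵐ t, 0 < t → HasDerivAt u (deriv u t) t) ∧
      ∀ t, 0 < t → ‖deriv u t‖ ≤ C := by
  have hb : ∀ t, 0 < t → ‖deriv u t‖ ≤ C := fun t ht =>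
    norm_deriv_le_of_lipschitzOn (Ioi_mem_nhds ht) hu
  have hd : ∀ᵐ t, 0 < t → HasDerivAt u (deriv u t) t := by
    filter_upwards [(ae_restrict_iff' measurableSet_Ioi).1
      (hu.ae_differentiableWithinAt_real measurableSet_Ioi)] with t ht h0
    exact ((ht h0).differentiableAt (Ioi_mem_nhds h0)).hasDerivAt
  have hm : AEStronglyMeasurable (deriv u) (volume.restrict (Ioi 0)) :=
    (stronglyMeasurable_deriv u).aestronglyMeasurable
  refine ⟨.of_absolutelyContinuous (fun a b ha hb i => ?_) hd hu.continuousOn ?_, hd, hb⟩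
  · have h1 : LipschitzOnWith C (fun t => u t i) (uIcc a b) := by
      refine LipschitzOnWith.of_dist_le_mul fun s hs t ht => ?_
      refine le_trans ?_ (hu.dist_le_mul s ((lt_min ha hb).trans_le hs.1) t
        ((lt_min ha hb).trans_le ht.1))
      rw [dist_eq_norm, dist_eq_norm, ← PiLp.sub_apply]
      exact PiLp.norm_apply_le _ i
    exact h1.absolutelyContinuousOnInterval
  · rw [locallyIntegrableOn_iff (isOpen_Ioi.isLocallyClosed)]
    intro K hK hKc
    obtain ⟨a, b, ha, hab, hKab⟩ := exists_Icc_of_isCompact hKc hK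
    have h1 := memLp_top_Icc_of_norm_le hm (a := a) (b := b)
      (fun t ht => ha.le.trans ht.1) (fun t _ => hb t) 1
    exact IntegrableOn.mono_set (memLp_one_iff_integrable.1 h1) (hKab.trans Ioo_subset_Icc_self)

theorem LipschitzOnWith.memSobolevLoc {C : NNReal} {u : ℝ → Plane}
    (hu : LipschitzOnWith C u (Ioi 0)) (p : ℝ≥0∞) : MemSobolevLoc p (Ici 0) u := by
  obtain ⟨h1, -, h3⟩ := hu.hasWeakDerivOn
  refine ⟨deriv u, by rwa [interior_Ici], fun a b hab => ⟨?_, ?_⟩⟩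
  · refine memLp_top_Icc_of_norm_le (C := ‖u 1‖ + C * (|a| + |b| + 1))
      (hu.continuousOn.aestronglyMeasurable measurableSet_Ioi) hab (fun t ht h0 => ?_) p
    have h4 := hu.dist_le_mul t h0 1 (mem_Ioi.2 one_pos)
    rw [dist_eq_norm] at h4
    have h5 : dist t 1 ≤ |a| + |b| + 1 := by
      rw [Real.dist_eq]
      have := ht.2.trans (le_abs_self b)
      have := abs_nonneg a
      exact abs_le.2 ⟨by linarith [abs_nonneg b], by linarith⟩
    have h6 := mul_le_mul_of_nonneg_left h5 C.2
    have h7 : ‖u t‖ ≤ ‖u 1‖ + ‖u t - u 1‖ := by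
      simpa using norm_add_le (u 1) (u t - u 1)
    exact h7.trans (add_le_add_right (h4.trans h6) _)
  · exact memLp_top_Icc_of_norm_le (stronglyMeasurable_deriv u).aestronglyMeasurable hab
      (fun t _ => h3 t) p

theorem IsTrajectory.isMildSolution {A : Type*} {f : Plane → A → Plane} {α : ℝ → A} {N L ε : ℝ}
    {x : Plane} {X : ℝ → Plane} (hg : IsDrift N L fun s y => f y (α s))
    (h : IsTrajectory f α ε x X) : IsMildSolution (fun s y => f y (α s)) ε x X :=
  ⟨h.initial, h.ode.hasRate h.continuousOn fun _ _ ha hb =>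
    hg.intervalIntegrable_velocity h.continuousOn ε ha hb⟩

theorem IsMildSolution.isTrajectory {A : Type*} {f : Plane → A → Plane} {α : ℝ → A} {N L ε : ℝ}
    {x : Plane} {X : ℝ → Plane} (hg : IsDrift N L fun s y => f y (α s))
    (h : IsMildSolution (fun s y => f y (α s)) ε x X) : IsTrajectory f α ε x X := by
  have hc := h.rate.continuousOn
  have hc' := hc.mono Ioi_subset_Ici_self
  refine ⟨hc, h.initial, ⟨velocity (fun s y => f y (α s)) ε X,
    by rw [interior_Ici]; exact h.rate.hasWeakDerivOn, fun a b hab => ⟨?_, ?_⟩⟩,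
    h.rate.hasWeakDerivOn⟩
  · obtain ⟨C, hC⟩ := isCompact_Icc.exists_bound_of_continuousOn (hc.mono hab)
    exact memLp_top_Icc_of_norm_le (hc'.aestronglyMeasurable measurableSet_Ioi) hab
      (fun t ht _ => hC t ht) _
  · have hp : ContinuousOn (fun s => ε⁻¹ • gradient pen (X s)) (Ici 0) :=
      (continuous_gradient_pen.comp_continuousOn hc).const_smul ε⁻¹
    obtain ⟨C, hC⟩ := isCompact_Icc.exists_bound_of_continuousOn (hp.mono hab)
    refine memLp_top_Icc_of_norm_le (C := N + C) ((hg.meas X hc').sub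
      ((hp.mono Ioi_subset_Ici_self).aestronglyMeasurable measurableSet_Ioi)) hab
      (fun t ht _ => ?_) _
    exact (norm_sub_le _ _).trans (add_le_add (hg.norm_le t (X t)) (hC t ht))

/-! ### Compactness of equicontinuous sequences on the open half-line -/

theorem tendstoLocallyUniformlyOn_of_equicontinuous {S : Set ℝ} {F : ℕ → ℝ → Plane}
    {u : ℝ → Plane}
    (heq : ∀ t₀ ∈ S, ∀ δ > 0, ∀ᶠ t in 𝓝[S] t₀, ∀ n, dist (F n t) (F n t₀) < δ)
    (hp : ∀ t ∈ S, Tendsto (fun n => F n t) atTop (𝓝 (u t))) :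
    TendstoLocallyUniformlyOn F u atTop S := by
  rw [Metric.tendstoLocallyUniformlyOn_iff]
  intro δ hδ t₀ ht₀
  refine ⟨{t | ∀ n, dist (F n t) (F n t₀) < δ / 4} ∩ S,
    inter_mem (heq t₀ ht₀ (δ / 4) (by positivity)) self_mem_nhdsWithin, ?_⟩
  filter_upwards [Metric.tendsto_nhds.1 (hp t₀ ht₀) (δ / 4) (by positivity)] with n hn t ht
  have h1 : dist (u t) (u t₀) ≤ δ / 4 :=
    le_of_tendsto ((hp t ht.2).dist (hp t₀ ht₀)) (Eventually.of_forall fun m => (ht.1 m).le)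
  have h2 := ht.1 n
  have h3 := dist_triangle4 (u t) (u t₀) (F n t₀) (F n t)
  rw [dist_comm (u t₀) (F n t₀), dist_comm (F n t₀) (F n t)] at h3
  linarith

theorem exists_subseq_tendsto_of_equicontinuous {F : ℕ → ℝ → Plane}
    (heq : ∀ t₀ ∈ Ioi (0 : ℝ), ∀ δ > 0, ∀ᶠ t in 𝓝[Ioi 0] t₀, ∀ n, dist (F n t) (F n t₀) < δ)
    (hb : ∀ t, 0 < t → ∃ C, ∀ n, ‖F n t‖ ≤ C) :
    ∃ (φ : ℕ → ℕ) (u : ℝ → Plane), StrictMono φ ∧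
      ∀ t, 0 < t → Tendsto (fun n => F (φ n) t) atTop (𝓝 (u t)) := by
  choose! C hC using hb
  -- A countable product of balls over the positive rationals replaces the diagonal extraction;
  -- equicontinuity then carries convergence to all t > 0.
  have hK : IsCompact (univ.pi fun q : {q : ℚ // 0 < q} =>
      Metric.closedBall (0 : Plane) (C (q : ℚ))) :=
    isCompact_univ_pi fun q => isCompact_closedBall _ _
  obtain ⟨v, -, φ, hφ, hv⟩ := hK.tendsto_subseq (x := fun n (q : {q : ℚ // 0 < q}) => F n ((q : ℚ) : ℝ)) (by
    intro n q _
    rw [mem_closedBall_zero_iff]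
    exact hC _ (by exact_mod_cast q.2) n)
  rw [tendsto_pi_nhds] at hv
  have hcau : ∀ t, 0 < t → ∃ y, Tendsto (fun n => F (φ n) t) atTop (𝓝 y) := by
    intro t ht
    apply cauchySeq_tendsto_of_complete
    rw [Metric.cauchySeq_iff']
    intro δ hδ
    have h1 := heq t ht (δ / 3) (by positivity)
    rw [nhdsWithin_eq_nhds.2 (Ioi_mem_nhds ht)] at h1
    obtain ⟨q, hq, hq0⟩ : ∃ q : ℚ, (∀ n, dist (F n q) (F n t) < δ / 3) ∧ (0 : ℝ) < q := by
      obtain ⟨q, hq⟩ := Rat.denseRange_cast.exists_mem_open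
        (isOpen_interior (s := {r | (∀ n, dist (F n r) (F n t) < δ / 3) ∧ (0 : ℝ) < r}))
        ⟨t, mem_interior_iff_mem_nhds.2 (h1.and (lt_mem_nhds ht))⟩
      have h2 := interior_subset hq
      exact ⟨q, h2.1, h2.2⟩
    have h2 := (hv ⟨q, by exact_mod_cast hq0⟩).cauchySeq
    obtain ⟨n₀, hn₀⟩ := Metric.cauchySeq_iff'.1 h2 (δ / 3) (by positivity)
    refine ⟨n₀, fun n hn => ?_⟩
    have h3 := hn₀ n hn
    have h4 := dist_triangle4 (F (φ n) t) (F (φ n) q) (F (φ n₀) q) (F (φ n₀) t)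
    have h5 := hq (φ n)
    have h6 := hq (φ n₀)
    rw [dist_comm] at h5
    simp only [Function.comp] at h3
    linarith
  choose! u hu using hcau
  exact ⟨φ, u, hφ, hu⟩

/-- A uniform Hölder-type estimate yields equicontinuity. -/
theorem eventually_dist_lt_of_norm_sq_sub_le {P : ℕ → ℝ → Plane} {s N C : ℝ}
    (hP : ∀ n a b, s ≤ a → a ≤ b →
      ‖P n b - P n a‖ ^ 2 ≤ (b - a) ^ 2 * N ^ 2 + 2 * (b - a) * (C + a * N ^ 2))
    {t₀ : ℝ} (ht₀ : s ≤ t₀) {δ : ℝ} (hδ : 0 < δ) :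
    ∀ᶠ t in 𝓝[Ici s] t₀, ∀ n, dist (P n t) (P n t₀) < δ := by
  have hlim : Tendsto (fun t => |t - t₀| ^ 2 * N ^ 2 + 2 * |t - t₀| * (C + t₀ * N ^ 2))
      (𝓝[Ici s] t₀) (𝓝 0) := by
    have hc : Continuous fun t => |t - t₀| ^ 2 * N ^ 2 + 2 * |t - t₀| * (C + t₀ * N ^ 2) := by
      fun_prop
    have := hc.tendsto t₀
    simp only [sub_self, abs_zero, ne_eq, OfNat.ofNat_ne_zero, not_false_eq_true, zero_pow,
      zero_mul, mul_zero, add_zero] at this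
    exact this.mono_left nhdsWithin_le_nhds
  filter_upwards [hlim.eventually (gt_mem_nhds (pow_pos hδ 2)), self_mem_nhdsWithin] with t h1 h2 n
  have h2 : s ≤ t := h2
  rw [dist_eq_norm]
  refine lt_of_pow_lt_pow_left₀ 2 hδ.le (lt_of_le_of_lt ?_ h1)
  rcases le_total t t₀ with hle | hle
  · rw [abs_of_nonpos (sub_nonpos.2 hle), norm_sub_rev]
    refine (hP n t t₀ h2 hle).trans ?_
    have h3 : C + t * N ^ 2 ≤ C + t₀ * N ^ 2 := by gcongr
    have h4 := mul_le_mul_of_nonneg_left h3 (mul_nonneg two_pos.le (sub_nonneg.2 hle))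
    rw [neg_sub]
    linarith
  · rw [abs_of_nonneg (sub_nonneg.2 hle)]
    exact hP n t₀ t ht₀ hle

theorem IsMildSolution.penaltyTerm_eq {N L ε : ℝ} {g : ℝ → Plane → Plane} {x : Plane}
    {X : ℝ → Plane} (hg : IsDrift N L g) (h : IsMildSolution g ε x X) {t : ℝ} (ht : 0 ≤ t) :
    penaltyTerm ε X t = x + (∫ s in (0 : ℝ)..t, g s (X s)) - X t := by
  have h1 := h.rate.eq t ht
  have h2 : ∫ s in (0 : ℝ)..t, velocity g ε X s =
      (∫ s in (0 : ℝ)..t, g s (X s)) - penaltyTerm ε X t := by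
    have i2 : IntervalIntegrable (fun s => ε⁻¹ • gradient pen (X s)) volume 0 t :=
      (intervalIntegrable_gradient_pen h.rate.continuousOn le_rfl ht).smul ε⁻¹
    rw [penaltyTerm, ← intervalIntegral.integral_smul, ← intervalIntegral.integral_sub
      (hg.intervalIntegrable (h.rate.continuousOn.mono Ioi_subset_Ici_self) le_rfl ht) i2]
    rfl
  rw [h2, h.initial] at h1
  rw [h1]
  abel

theorem IsDrift.norm_integral_le {N L : ℝ} {g : ℝ → Plane → Plane} (hg : IsDrift N L g)
    (X : ℝ → Plane) {t : ℝ} (ht : 0 ≤ t) : ‖∫ s in (0 : ℝ)..t, g s (X s)‖ ≤ N * t := by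
  have := intervalIntegral.norm_integral_le_of_norm_le_const (a := 0) (b := t)
    fun s _ => hg.norm_le s (X s)
  simpa [abs_of_nonneg ht] using this

/-! ### The limit of vanishing ε -/

/-- A family of mild solutions with common drift and initial point and vanishing parameters. -/
structure IsVanishingFamily (g : ℝ → Plane → Plane) (x : Plane) (ε : ℕ → ℝ)
    (Xs : ℕ → ℝ → Plane) : Prop where
  pos : ∀ n, 0 < ε n
  tendsto : Tendsto ε atTop (𝓝 0)
  mild : ∀ n, IsMildSolution g (ε n) x (Xs n)

namespace IsVanishingFamily

variable {N L : ℝ} {g : ℝ → Plane → Plane} {x : Plane} {ε : ℕ → ℝ} {Xs : ℕ → ℝ → Plane}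

theorem comp (h : IsVanishingFamily g x ε Xs) {φ : ℕ → ℕ} (hφ : StrictMono φ) :
    IsVanishingFamily g x (fun n => ε (φ n)) (fun n => Xs (φ n)) :=
  ⟨fun _ => h.pos _, h.tendsto.comp hφ.tendsto_atTop, fun _ => h.mild _⟩

theorem tendsto_inv_mul_pen (hg : IsDrift N L g) (h : IsVanishingFamily g x ε Xs) {t : ℝ}
    (ht : 0 < t) : Tendsto (fun n => (ε n)⁻¹ * pen (Xs n t)) atTop (𝓝 0) := by
  refine squeeze_zero
    (fun n => mul_nonneg (inv_nonneg.2 (h.pos n).le) (pen_nonneg _))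
    (fun n => (h.mild n).inv_mul_pen_le hg (h.pos n) ht) ?_
  have h1 : Tendsto (fun n => ε n ^ (1 / 3 : ℝ)) atTop (𝓝 0) := by
    have := h.tendsto.rpow_const (p := 1 / 3) (Or.inr (by norm_num))
    rwa [Real.zero_rpow (by norm_num)] at this
  simpa using h1.mul_const (24 / (6 * t) ^ 4 * pen x + N ^ 2 / 12 + 1 / 3)

theorem tendsto_pen (hg : IsDrift N L g) (h : IsVanishingFamily g x ε Xs) {t : ℝ}
    (ht : 0 < t) : Tendsto (fun n => pen (Xs n t)) atTop (𝓝 0) := by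
  have := h.tendsto.mul (h.tendsto_inv_mul_pen hg ht)
  rw [mul_zero] at this
  refine this.congr fun n => ?_
  rw [mul_inv_cancel_left₀ (h.pos n).ne']

theorem exists_bound (hg : IsDrift N L g) (h : IsVanishingFamily g x ε Xs) {s : ℝ}
    (hs : 0 < s) : ∃ C, ∀ n, (ε n)⁻¹ * pen (Xs n s) ≤ C := by
  obtain ⟨C, hC⟩ := (h.tendsto_inv_mul_pen hg hs).bddAbove_range
  exact ⟨C, fun n => hC (mem_range_self n)⟩

theorem increment_bound (hg : IsDrift N L g) (h : IsVanishingFamily g x ε Xs) {s C : ℝ}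
    (hs : 0 ≤ s) (hC : ∀ n, (ε n)⁻¹ * pen (Xs n s) ≤ C) (n : ℕ) {a b : ℝ} (ha : s ≤ a)
    (hab : a ≤ b) :
    (b - a) ^ 2 * N ^ 2 + 2 * (b - a) * ((ε n)⁻¹ * pen (Xs n a) - (ε n)⁻¹ * pen (Xs n b)) ≤
      (b - a) ^ 2 * N ^ 2 + 2 * (b - a) * (C + a * N ^ 2) := by
  have h1 := (h.mild n).inv_mul_pen_le_add hg hs ha
  have h2 := hC n
  have h3 : 0 ≤ (ε n)⁻¹ * pen (Xs n b) := mul_nonneg (inv_nonneg.2 (h.pos n).le) (pen_nonneg _)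
  have h4 : (a - s) * N ^ 2 ≤ a * N ^ 2 := by
    apply mul_le_mul_of_nonneg_right _ (sq_nonneg N); linarith
  have h5 : 0 ≤ 2 * (b - a) := by linarith
  gcongr
  linarith

theorem equicontinuous_Ici (hg : IsDrift N L g) (h : IsVanishingFamily g x ε Xs) {s C : ℝ}
    (hs : 0 ≤ s) (hC : ∀ n, (ε n)⁻¹ * pen (Xs n s) ≤ C) {t₀ : ℝ} (ht₀ : s ≤ t₀)
    {δ : ℝ} (hδ : 0 < δ) :
    (∀ᶠ t in 𝓝[Ici s] t₀, ∀ n, dist (Xs n t) (Xs n t₀) < δ) ∧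
      ∀ᶠ t in 𝓝[Ici s] t₀, ∀ n,
        dist (penaltyTerm (ε n) (Xs n) t) (penaltyTerm (ε n) (Xs n) t₀) < δ :=
  ⟨eventually_dist_lt_of_norm_sq_sub_le (fun n _ _ ha hab =>
      ((h.mild n).norm_sq_sub_le hg (hs.trans ha) hab).trans
        (h.increment_bound hg hs hC n ha hab)) ht₀ hδ,
    eventually_dist_lt_of_norm_sq_sub_le (P := fun n => penaltyTerm (ε n) (Xs n))
      (fun n _ _ ha hab =>
      ((h.mild n).norm_sq_penaltyTerm_sub_le hg (hs.trans ha) hab).trans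
        (h.increment_bound hg hs hC n ha hab)) ht₀ hδ⟩

theorem equicontinuous_Ioi (hg : IsDrift N L g) (h : IsVanishingFamily g x ε Xs) {t₀ : ℝ}
    (ht₀ : t₀ ∈ Ioi (0 : ℝ)) {δ : ℝ} (hδ : δ > 0) :
    (∀ᶠ t in 𝓝[Ioi 0] t₀, ∀ n, dist (Xs n t) (Xs n t₀) < δ) ∧
      ∀ᶠ t in 𝓝[Ioi 0] t₀, ∀ n,
        dist (penaltyTerm (ε n) (Xs n) t) (penaltyTerm (ε n) (Xs n) t₀) < δ := by
  have ht₀ : 0 < t₀ := ht₀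
  obtain ⟨C, hC⟩ := h.exists_bound hg (half_pos ht₀)
  have := h.equicontinuous_Ici hg (half_pos ht₀).le hC (half_le_self ht₀.le) hδ
  rw [nhdsWithin_eq_nhds.2 (Ici_mem_nhds (half_lt_self ht₀))] at this
  exact ⟨this.1.filter_mono nhdsWithin_le_nhds, this.2.filter_mono nhdsWithin_le_nhds⟩

theorem exists_subseq_isLimitPair (hg : IsDrift N L g) (h : IsVanishingFamily g x ε Xs) :
    ∃ (φ : ℕ → ℕ) (X k : ℝ → Plane), StrictMono φ ∧
      IsLimitPair (fun n => Xs (φ n)) (fun n => penaltyTerm (ε (φ n)) (Xs (φ n))) X k := by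
  obtain ⟨φ, u, hφ, hu⟩ := exists_subseq_tendsto_of_equicontinuous (F := Xs)
    (fun t₀ ht₀ δ hδ => (h.equicontinuous_Ioi hg ht₀ hδ).1)
    (fun t ht => ⟨_, fun n => (h.mild n).norm_le hg (h.pos n) ht.le⟩)
  have h' := h.comp hφ
  obtain ⟨ψ, v, hψ, hv⟩ := exists_subseq_tendsto_of_equicontinuous
    (F := fun n => penaltyTerm (ε (φ n)) (Xs (φ n)))
    (fun t₀ ht₀ δ hδ => (h'.equicontinuous_Ioi hg ht₀ hδ).2)
    (fun t ht => ⟨‖x‖ + N * t + Real.exp t * (‖x‖ + N), fun n => by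
      rw [(h'.mild n).penaltyTerm_eq hg ht.le]
      refine (norm_sub_le _ _).trans (add_le_add ((norm_add_le _ _).trans ?_)
        ((h'.mild n).norm_le hg (h'.pos n) ht.le))
      exact add_le_add_right (hg.norm_integral_le _ ht.le) _⟩)
  have h'' := h'.comp hψ
  have hne : ∀ t ∈ Ioi (0 : ℝ), t ≠ 0 := fun t ht => ne_of_gt ht
  -- The values at 0 are prescribed, x and 0 being the common initial values; the extraction only
  -- saw t > 0, and the right limits at 0 differ from these values when x is off the network.
  refine ⟨φ ∘ ψ, Function.update u 0 x, Function.update v 0 0, hφ.comp hψ, ?_, ?_, ?_, ?_⟩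
  · refine tendstoLocallyUniformlyOn_of_equicontinuous
      (fun t₀ ht₀ δ hδ => (h''.equicontinuous_Ioi hg ht₀ hδ).1) fun t ht => ?_
    rw [Function.update_of_ne (hne t ht)]
    exact (hu t ht).comp hψ.tendsto_atTop
  · refine tendstoLocallyUniformlyOn_of_equicontinuous
      (fun t₀ ht₀ δ hδ => (h''.equicontinuous_Ioi hg ht₀ hδ).2) fun t ht => ?_
    rw [Function.update_of_ne (hne t ht)]
    exact hv t ht
  · simp only [Function.update_self]
    exact tendsto_const_nhds.congr fun n => ((h''.mild n).initial).symm
  · simp [penaltyTerm]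

variable {X k : ℝ → Plane}

theorem tendsto_X (hl : IsLimitPair Xs (fun n => penaltyTerm (ε n) (Xs n)) X k) {t : ℝ}
    (ht : 0 ≤ t) : Tendsto (fun n => Xs n t) atTop (𝓝 (X t)) := by
  rcases ht.eq_or_lt with rfl | ht
  · exact hl.zero_X
  · exact hl.unif_X.tendsto_at ht

theorem tendsto_k (hl : IsLimitPair Xs (fun n => penaltyTerm (ε n) (Xs n)) X k) {t : ℝ}
    (ht : 0 ≤ t) : Tendsto (fun n => penaltyTerm (ε n) (Xs n) t) atTop (𝓝 (k t)) := by
  rcases ht.eq_or_lt with rfl | ht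
  · exact hl.zero_k
  · exact hl.unif_k.tendsto_at ht

/-- At two positive times the energies tend to 0, and the energy estimate becomes |Q(t) - Q(s)|² ≤
N²(t - s)². -/
theorem lipschitzOnWith (hg : IsDrift N L g) (h : IsVanishingFamily g x ε Xs)
    (hl : IsLimitPair Xs (fun n => penaltyTerm (ε n) (Xs n)) X k) :
    LipschitzOnWith N.toNNReal X (Ioi 0) ∧ LipschitzOnWith N.toNNReal k (Ioi 0) := by
  have hN := hg.nonneg
  have main : ∀ (P : ℕ → ℝ → Plane) (Q : ℝ → Plane),
      (∀ t, 0 < t → Tendsto (fun n => P n t) atTop (𝓝 (Q t))) →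
      (∀ n s t, 0 < s → s ≤ t → ‖P n t - P n s‖ ^ 2 ≤ (t - s) ^ 2 * N ^ 2 +
        2 * (t - s) * ((ε n)⁻¹ * pen (Xs n s) - (ε n)⁻¹ * pen (Xs n t))) →
      LipschitzOnWith N.toNNReal Q (Ioi 0) := by
    intro P Q hPQ hP
    have hle : ∀ s t, 0 < s → s ≤ t → ‖Q t - Q s‖ ≤ N * (t - s) := by
      intro s t hs hst
      have ht := hs.trans_le hst
      have h1 : Tendsto (fun n => ‖P n t - P n s‖ ^ 2) atTop (𝓝 (‖Q t - Q s‖ ^ 2)) :=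
        ((hPQ t ht).sub (hPQ s hs)).norm.pow 2
      have h2 := (((h.tendsto_inv_mul_pen hg hs).sub (h.tendsto_inv_mul_pen hg ht)).const_mul
        (2 * (t - s))).const_add ((t - s) ^ 2 * N ^ 2)
      have h3 := le_of_tendsto_of_tendsto' h1 h2 fun n => hP n s t hs hst
      refine abs_le_of_sq_le_sq' ?_ (mul_nonneg hN (sub_nonneg.2 hst)) |>.2
      linarith
    refine LipschitzOnWith.of_dist_le_mul fun s hs t ht => ?_
    rw [Real.coe_toNNReal _ hN, dist_eq_norm, Real.dist_eq]
    rcases le_total s t with hst | hst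
    · rw [norm_sub_rev, abs_sub_comm, abs_of_nonneg (sub_nonneg.2 hst)]
      exact hle s t hs hst
    · rw [abs_of_nonneg (sub_nonneg.2 hst)]
      exact hle t s ht hst
  exact ⟨main Xs X (fun t ht => tendsto_X hl ht.le)
      fun n s t hs hst => (h.mild n).norm_sq_sub_le hg hs.le hst,
    main _ k (fun t ht => tendsto_k hl ht.le)
      fun n s t hs hst => (h.mild n).norm_sq_penaltyTerm_sub_le hg hs.le hst⟩

theorem limit_eq (hg : IsDrift N L g) (h : IsVanishingFamily g x ε Xs)
    (hl : IsLimitPair Xs (fun n => penaltyTerm (ε n) (Xs n)) X k) {t : ℝ} (ht : 0 ≤ t) :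
    X t = x + (∫ s in (0 : ℝ)..t, g s (X s)) - k t := by
  have hint : Tendsto (fun n => ∫ s in (0 : ℝ)..t, g s (Xs n s)) atTop
      (𝓝 (∫ s in (0 : ℝ)..t, g s (X s))) := by
    refine intervalIntegral.tendsto_integral_filter_of_dominated_convergence (fun _ => N)
      (Eventually.of_forall fun n => ?_) (Eventually.of_forall fun n => ?_)
      intervalIntegrable_const ?_
    · have := hg.intervalIntegrable
        ((h.mild n).rate.continuousOn.mono Ioi_subset_Ici_self) le_rfl ht
      exact (intervalIntegrable_iff.1 this).aestronglyMeasurable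
    · exact Eventually.of_forall fun s _ => hg.norm_le s _
    · refine Eventually.of_forall fun s hs => ?_
      rw [uIoc_of_le ht] at hs
      have h1 := tendsto_X hl hs.1.le
      have hc : Continuous (g s) :=
        (LipschitzWith.of_dist_le_mul (K := L.toNNReal) fun y z => by
          rw [dist_eq_norm, dist_eq_norm]
          exact (hg.lip s y z).trans (mul_le_mul_of_nonneg_right (Real.le_coe_toNNReal L)
            (norm_nonneg _))).continuous
      exact (hc.tendsto _).comp h1
  have h1 := (hint.const_add x).sub (tendsto_X hl ht)
  have h2 := tendsto_nhds_unique (tendsto_k hl ht)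
    (h1.congr fun n => ((h.mild n).penaltyTerm_eq hg ht).symm)
  rw [h2]
  abel

theorem pen_limit_eq_zero (hg : IsDrift N L g) (h : IsVanishingFamily g x ε Xs)
    (hl : IsLimitPair Xs (fun n => penaltyTerm (ε n) (Xs n)) X k) {t : ℝ} (ht : 0 < t) :
    pen (X t) = 0 :=
  tendsto_nhds_unique ((continuous_pen.tendsto _).comp (tendsto_X hl ht.le))
    (h.tendsto_pen hg ht)

/-- The order of limits matters: at fixed small t, letting ε vanish kills √d, and what remains is a
bound B(t) free of ε; then t tends to 0. -/
theorem tendsto_limit_zero (hg : IsDrift N L g) (h : IsVanishingFamily g x ε Xs)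
    (hl : IsLimitPair Xs (fun n => penaltyTerm (ε n) (Xs n)) X k) :
    Tendsto X (𝓝[>] 0) (𝓝 (flowLimit x)) := by
  set B : ℝ → ℝ := fun t => 2 * N * (Real.exp t * (‖x‖ + N)) * t with hB
  have hB0 : Tendsto B (𝓝[>] 0) (𝓝 0) := by
    have hc : Continuous B := by fun_prop
    have := hc.tendsto 0
    simp only [hB, mul_zero] at this
    exact this.mono_left nhdsWithin_le_nhds
  have hsmall : ∀ᶠ t in 𝓝[>] (0 : ℝ), B t < |hyp x| ∨ hyp x = 0 := by
    by_cases h0 : hyp x = 0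
    · exact Eventually.of_forall fun t => Or.inr h0
    · filter_upwards [hB0.eventually (gt_mem_nhds (abs_pos.2 h0))] with t ht using Or.inl ht
  have hbound : ∀ᶠ t in 𝓝[>] (0 : ℝ), ‖X t - flowLimit x‖ ^ 2 ≤ 4 * B t := by
    filter_upwards [hsmall, self_mem_nhdsWithin] with t ht h0
    have h0 : (0 : ℝ) < t := h0
    have h1 : Tendsto (fun n => ‖Xs n t - flowLimit x‖ ^ 2) atTop
        (𝓝 (‖X t - flowLimit x‖ ^ 2)) := ((tendsto_X hl h0.le).sub_const _).norm.pow 2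
    have h2 : Tendsto (fun n => 4 * (B t + √(pen (Xs n t)))) atTop (𝓝 (4 * (B t + √0))) :=
      (((Real.continuous_sqrt.tendsto 0).comp (h.tendsto_pen hg h0)).const_add (B t)).const_mul 4
    have h3 := le_of_tendsto_of_tendsto' h1 h2 fun n =>
      (h.mild n).norm_sq_sub_flowLimit_le hg (h.pos n) h0.le ht
    simpa using h3
  have hsq : Tendsto (fun t => ‖X t - flowLimit x‖ ^ 2) (𝓝[>] 0) (𝓝 0) :=
    squeeze_zero' (Eventually.of_forall fun t => sq_nonneg _) hbound
      (by simpa using hB0.const_mul 4)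
  rw [tendsto_iff_norm_sub_tendsto_zero]
  have := hsq.sqrt
  simpa using this

theorem tendsto_limit_zero_k (hg : IsDrift N L g) (h : IsVanishingFamily g x ε Xs)
    (hl : IsLimitPair Xs (fun n => penaltyTerm (ε n) (Xs n)) X k) :
    Tendsto k (𝓝[>] 0) (𝓝 (x - flowLimit x)) := by
  have hI : Tendsto (fun t => ∫ s in (0 : ℝ)..t, g s (X s)) (𝓝[>] 0) (𝓝 0) := by
    refine squeeze_zero_norm' (a := fun t => N * t) ?_ ?_
    · filter_upwards [self_mem_nhdsWithin] with t ht
      exact hg.norm_integral_le X (le_of_lt ht)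
    · have hc : Continuous fun t : ℝ => N * t := by fun_prop
      have := hc.tendsto 0
      rw [mul_zero] at this
      exact this.mono_left nhdsWithin_le_nhds
  have h1 := (hI.const_add x).sub (h.tendsto_limit_zero hg hl)
  rw [add_zero] at h1
  refine h1.congr' ?_
  filter_upwards [self_mem_nhdsWithin] with t ht
  have := h.limit_eq hg hl (le_of_lt ht)
  rw [sub_eq_iff_eq_add, this]
  abel

/-- Since d(x) = 0, the energy bound starts at time 0, and equicontinuity extends to the closed
half-line. -/
theorem tendstoLocallyUniformlyOn_Ici (hg : IsDrift N L g) (h : IsVanishingFamily g x ε Xs)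
    (hl : IsLimitPair Xs (fun n => penaltyTerm (ε n) (Xs n)) X k) (hx : x ∈ network) :
    TendstoLocallyUniformlyOn Xs X atTop (Ici 0) ∧
      TendstoLocallyUniformlyOn (fun n => penaltyTerm (ε n) (Xs n)) k atTop (Ici 0) := by
  have hC : ∀ n, (ε n)⁻¹ * pen (Xs n 0) ≤ 0 := fun n => by
    rw [(h.mild n).initial, (mem_network_iff x).1 hx, mul_zero]
  exact ⟨tendstoLocallyUniformlyOn_of_equicontinuous
      (fun t₀ ht₀ δ hδ => (h.equicontinuous_Ici hg le_rfl hC ht₀ hδ).1)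
      fun t ht => tendsto_X hl ht,
    tendstoLocallyUniformlyOn_of_equicontinuous
      (fun t₀ ht₀ δ hδ => (h.equicontinuous_Ici hg le_rfl hC ht₀ hδ).2)
      fun t ht => tendsto_k hl ht⟩

end IsVanishingFamily

/-! ### Gradient descent as the case of zero drift, and conclusion -/

theorem isDrift_zero : IsDrift 0 0 (fun _ _ => 0) :=
  ⟨fun _ _ => by simp, fun _ _ _ => by simp, fun _ _ => aestronglyMeasurable_const⟩

theorem velocity_zero_one (Z : ℝ → Plane) :
    velocity (fun _ _ => 0) 1 Z = fun t => -gradient pen (Z t) := by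
  ext1 t; simp [velocity]

theorem IsMildSolution.isGradientFlow {x : Plane} {Z : ℝ → Plane}
    (h : IsMildSolution (fun _ _ => 0) 1 x Z) : IsGradientFlow x Z := by
  refine ⟨h.initial, fun t ht => ?_⟩
  have hr := h.rate
  rw [velocity_zero_one] at hr
  have hc := hr.continuousOn
  set Y : ℝ → Plane := fun s => Z (max s 0) with hY
  have hYc : Continuous Y := by
    rw [← continuousOn_univ]
    exact hc.comp (by fun_prop) fun s _ => mem_Ici.2 (le_max_right _ _)
  have hYZ : ∀ s, 0 ≤ s → Y s = Z s := fun s hs => by simp [hY, max_eq_left hs]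
  have hgc : Continuous fun s => -gradient pen (Y s) := (continuous_gradient_pen.comp hYc).neg
  have hd : HasDerivAt (fun t => Z 0 + ∫ s in (0 : ℝ)..t, -gradient pen (Y s))
      (-gradient pen (Y t)) t :=
    (intervalIntegral.integral_hasDerivAt_right (hgc.intervalIntegrable _ _)
      (hgc.stronglyMeasurableAtFilter _ _) hgc.continuousAt).const_add (Z 0)
  have he : EqOn Z (fun t => Z 0 + ∫ s in (0 : ℝ)..t, -gradient pen (Y s)) (Ici 0) := by
    intro r hr0
    have hr0 : (0 : ℝ) ≤ r := hr0
    rw [hr.eq r hr0]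
    simp only [add_right_inj]
    refine intervalIntegral.integral_congr fun s hs => ?_
    rw [uIcc_of_le hr0] at hs
    simp only [hYZ s hs.1]
  rw [← hYZ t ht]
  exact hd.hasDerivWithinAt.congr he (he ht)

theorem IsGradientFlow.isMildSolution {x : Plane} {W : ℝ → Plane} (h : IsGradientFlow x W) :
    IsMildSolution (fun _ _ => 0) 1 x W := by
  have hc : ContinuousOn W (Ici 0) := fun t ht => (h.ode t ht).continuousWithinAt
  refine .of_integral_eq isDrift_zero hc fun t ht => ?_
  have hsub : Icc 0 t ⊆ Ici 0 := fun s hs => hs.1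
  rw [velocity_zero_one, intervalIntegral.integral_eq_sub_of_hasDeriv_right_of_le ht (f := W)
    (hc.mono hsub) (fun s hs => (h.ode s hs.1.le).mono
      fun r hr => hs.1.le.trans (le_of_lt hr))
    (intervalIntegrable_gradient_pen hc le_rfl ht).neg, h.initial]
  abel

theorem IsMildSolution.tendsto_flowLimit {x : Plane} {Z : ℝ → Plane}
    (h : IsMildSolution (fun _ _ => 0) 1 x Z) : Tendsto Z atTop (𝓝 (flowLimit x)) := by
  have hpen : Tendsto (fun t => pen (Z t)) atTop (𝓝 0) := by
    refine squeeze_zero' (g := fun t => t⁻¹ ^ 2 * (24 / 6 ^ 4 * pen x) + t⁻¹ * 3⁻¹)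
      (Eventually.of_forall fun t => pen_nonneg _) ?_ ?_
    · filter_upwards [eventually_gt_atTop 0] with t ht
      -- Writing t = r² allows the level `lam` = t^(-1/2); with no drift, both terms of the decay
      -- bound then tend to 0 as t grows.
      obtain ⟨r, hr, rfl⟩ : ∃ r, 0 < r ∧ t = r ^ 2 :=
        ⟨√t, Real.sqrt_pos.2 ht, (Real.sq_sqrt ht.le).symm⟩
      refine (h.pen_le isDrift_zero one_pos (inv_pos.2 hr) ht).trans (le_of_eq ?_)
      field_simp
      ring
    · have hi : Tendsto (fun t : ℝ => t⁻¹) atTop (𝓝 0) := tendsto_inv_atTop_zero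
      simpa using ((hi.pow 2).mul_const (24 / 6 ^ 4 * pen x)).add (hi.mul_const 3⁻¹)
  have hsq : Tendsto (fun t => ‖Z t - flowLimit x‖ ^ 2) atTop (𝓝 0) := by
    refine squeeze_zero' (g := fun t => 4 * √(pen (Z t)))
      (Eventually.of_forall fun t => sq_nonneg _) ?_ ?_
    · filter_upwards [eventually_ge_atTop 0] with t ht
      have h0 : 0 < |hyp x| ∨ hyp x = 0 := by
        rcases eq_or_ne (hyp x) 0 with h0 | h0
        · exact Or.inr h0
        · exact Or.inl (abs_pos.2 h0)
      have := h.norm_sq_sub_flowLimit_le isDrift_zero one_pos ht (by simpa using h0)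
      simpa using this
    · simpa using (hpen.sqrt).const_mul 4
  rw [tendsto_iff_norm_sub_tendsto_zero]
  simpa using hsq.sqrt

theorem isDrift_of_control {A : Type*} [MetricSpace A] [CompactSpace A] [MeasurableSpace A]
    [BorelSpace A] {f : Plane → A → Plane} (hf_cont : Continuous (Function.uncurry f))
    {M : ℝ} (hf_bdd : ∀ x a, ‖f x a‖ ≤ M) (hf_lip : ∀ x y a, ‖f x a - f y a‖ ≤ M * ‖x - y‖)
    {α : ℝ → A} (hα : AEMeasurable α (volume.restrict (Ioi 0))) :
    IsDrift (supNorm f) M fun s y => f y (α s) := by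
  refine ⟨fun s y => ?_, fun s y z => hf_lip y z (α s), fun Y hY => ?_⟩
  · have hb : BddAbove (range fun p : Plane × A => ‖f p.1 p.2‖) :=
      ⟨M, by rintro _ ⟨p, rfl⟩; exact hf_bdd _ _⟩
    exact le_ciSup hb (y, α s)
  · have hYm : AEMeasurable Y (volume.restrict (Ioi 0)) := hY.aemeasurable measurableSet_Ioi
    exact (hf_cont.measurable.comp_aemeasurable (hYm.prodMk hα)).aestronglyMeasurable

end

theorem theorem1 {A : Type*} [MetricSpace A] [CompactSpace A] [MeasurableSpace A] [BorelSpace A]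
    (f : Plane → A → Plane) (hf_cont : Continuous (Function.uncurry f))
    (M : ℝ) (hM : 0 < M) (hf_bdd : ∀ x a, ‖f x a‖ ≤ M)
    (hf_lip : ∀ x y a, ‖f x a - f y a‖ ≤ M * ‖x - y‖)
    (x : Plane) (α : ℝ → A) (hα : AEMeasurable α (volume.restrict (Ioi 0))) :
    -- well-posedness of the perturbed equation
    (∀ ε : ℝ, 0 < ε → ∃ X : ℝ → Plane, IsTrajectory f α ε x X ∧
      ∀ Y : ℝ → Plane, IsTrajectory f α ε x Y → EqOn Y X (Ici 0)) ∧
    -- well-posedness of the gradient descent, and its limit `xbar`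
    ∃ (Z : ℝ → Plane) (xbar : Plane),
      (IsGradientFlow x Z ∧ ∀ W : ℝ → Plane, IsGradientFlow x W → EqOn W Z (Ici 0)) ∧
      Tendsto Z atTop (𝓝 xbar) ∧ xbar ∈ network ∧
      -- the family of perturbed trajectories, and any sequence of parameters tending to `0⁺`
      ∀ Xeps : ℝ → ℝ → Plane, (∀ ε : ℝ, 0 < ε → IsTrajectory f α ε x (Xeps ε)) →
      ∀ ε : ℕ → ℝ, (∀ n, 0 < ε n) → Tendsto ε atTop (𝓝 0) →
        -- compactness
        (∃ (φ : ℕ → ℕ) (X k : ℝ → Plane), StrictMono φ ∧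
          IsLimitPair (fun n => Xeps (ε (φ n)))
            (fun n => penaltyTerm (ε (φ n)) (Xeps (ε (φ n)))) X k) ∧
        -- properties of the limits
        ∀ X k : ℝ → Plane,
          IsLimitPair (fun n => Xeps (ε n)) (fun n => penaltyTerm (ε n) (Xeps (ε n))) X k →
          MemSobolevLoc 2 (Ioi 0) X ∧ MemSobolevLoc 2 (Ioi 0) k ∧
          (∀ t : ℝ, 0 ≤ t →
            IntervalIntegrable (fun s => f (X s) (α s)) volume 0 t ∧
            X t = x + (∫ s in (0 : ℝ)..t, f (X s) (α s)) - k t) ∧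
          (∀ t : ℝ, 0 < t → X t ∈ network) ∧
          Tendsto X (𝓝[>] 0) (𝓝 xbar) ∧ Tendsto k (𝓝[>] 0) (𝓝 (x - xbar)) ∧
          -- initial point on the network
          (x ∈ network →
            TendstoLocallyUniformlyOn (fun n => Xeps (ε n)) X atTop (Ici 0) ∧
            TendstoLocallyUniformlyOn (fun n => penaltyTerm (ε n) (Xeps (ε n))) k atTop (Ici 0) ∧
            MemSobolevLoc 2 (Ici 0) X ∧ MemSobolevLoc 2 (Ici 0) k) ∧
          -- estimates on the derivatives
          MemSobolevLoc ∞ (Ioi 0) X ∧ MemSobolevLoc ∞ (Ioi 0) k ∧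
          ∃ X' k' : ℝ → Plane,
            HasWeakDerivOn (Ioi 0) X X' ∧ HasWeakDerivOn (Ioi 0) k k' ∧
            ∀ᵐ t ∂(volume.restrict (Ioi (0 : ℝ))),
              HasDerivAt X (X' t) t ∧ HasDerivAt k (k' t) t ∧
              ‖X' t‖ ≤ supNorm f ∧ ‖k' t‖ ≤ supNorm f := by
  have hg := isDrift_of_control hf_cont hf_bdd hf_lip hα
  refine ⟨fun ε hε => ?_, ?_⟩
  · obtain ⟨X, hX⟩ := exists_isMildSolution hg hε x
    exact ⟨X, hX.isTrajectory hg, fun Y hY => (hY.isMildSolution hg).eqOn hg hε hX⟩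
  obtain ⟨Z, hZ⟩ := exists_isMildSolution isDrift_zero one_pos x
  refine ⟨Z, flowLimit x, ⟨hZ.isGradientFlow, fun W hW =>
    hW.isMildSolution.eqOn isDrift_zero one_pos hZ⟩, hZ.tendsto_flowLimit,
    flowLimit_mem_network x, fun Xeps hXeps ε hε hε0 => ?_⟩
  have hfam : IsVanishingFamily (fun s y => f y (α s)) x ε (fun n => Xeps (ε n)) :=
    ⟨hε, hε0, fun n => (hXeps (ε n) (hε n)).isMildSolution hg⟩
  refine ⟨hfam.exists_subseq_isLimitPair hg, fun X k hl => ?_⟩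
  obtain ⟨hX, hk⟩ := hfam.lipschitzOnWith hg hl
  obtain ⟨hX1, hX2, hX3⟩ := hX.hasWeakDerivOn
  obtain ⟨hk1, hk2, hk3⟩ := hk.hasWeakDerivOn
  rw [Real.coe_toNNReal _ hg.nonneg] at hX3 hk3
  have hunif := hfam.tendstoLocallyUniformlyOn_Ici hg hl
  refine ⟨(hX.memSobolevLoc 2).restrict_Ioi, (hk.memSobolevLoc 2).restrict_Ioi, fun t ht =>
    ⟨hg.intervalIntegrable hX.continuousOn le_rfl ht, hfam.limit_eq hg hl ht⟩,
    fun t ht => (mem_network_iff _).2 (hfam.pen_limit_eq_zero hg hl ht),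
    hfam.tendsto_limit_zero hg hl, hfam.tendsto_limit_zero_k hg hl,
    fun hx => ⟨(hunif hx).1, (hunif hx).2, hX.memSobolevLoc 2, hk.memSobolevLoc 2⟩,
    (hX.memSobolevLoc ∞).restrict_Ioi, (hk.memSobolevLoc ∞).restrict_Ioi, deriv X, deriv k, hX1, hk1, ?_⟩
  rw [ae_restrict_iff' measurableSet_Ioi]
  filter_upwards [hX2, hk2] with t h1 h2 h0
  exact ⟨h1 h0, h2 h0, hX3 t h0, hk3 t h0⟩
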